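/- Let $\mathbb S^2\subset\mathbb R^3$ be the unit sphere with its surface measure $d\Omega=\sin\theta\,d\theta\,d\varphi$, let $P_\ell$ be the Legendre polynomial of degree $\ell$, and for $\ell\ge 0$, $-\ell\le m\le\ell$ let $$Y_\ell^m(\theta,\varphi)=\frac{e^{im\varphi}}{\sqrt{2\pi}}\,i^{m+|m|}\sqrt{\bigl(\ell+\tfrac12\bigr)\frac{(\ell-m)!}{(\ell+m)!}}\;P_\ell^m(\cos\theta)$$ be the spherical harmonics ($\theta$ the colatitude, $\varphi$ the longitude), where $P_\ell^m(t)=(-1)^m(1-t^2)^{m/2}\frac{d^m}{dt^m}P_\ell(t)$ for $m\ge0$ and $P_\ell^{-m}=(-1)^m\frac{(\ell-m)!}{(\ell+m)!}P_\ell^m$. For a kernel $\rho_\delta$, a real function of the Euclidean distance, and $u:\mathbb S^2\to\mathbb C$ let $$\mathcal L_\delta u(\mathbf x)=\int_{\mathbb S^2}\rho_\delta(|\mathbf x-\mathbf y|)\,[u(\mathbf y)-u(\mathbf x)]\,d\Omega(\mathbf y):=\lim_{\varepsilon\to0^+}\int_{\{\mathbf y\in\mathbb S^2:\ |\mathbf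 x-\mathbf y|>\varepsilon\}}\rho_\delta(|\mathbf x-\mathbf y|)\,[u(\mathbf y)-u(\mathbf x)]\,d\Omega(\mathbf y)$$ (the truncated integrals being required to converge absolutely). (i) Suppose that $t\mapsto(1-t)\,\rho_\delta(\sqrt{2(1-t)})$ belongs to $L^1([-1,1])$. Then for every $\ell\ge0$ the integral $$\lambda_\delta(\ell)=2\pi\int_{-1}^{1}[P_\ell(t)-1]\,\rho_\delta(\sqrt{2(1-t)})\,dt$$ converges absolutely, and for all $-\ell\le m\le\ell$ the function $Y_\ell^m$ is an eigenfunction of $\mathcal L_\delta$ with eigenvalue $\lambda_\delta(\ell)$: $Y_\ell^m\not\equiv0$, and for every $\mathbf x\in\mathbb S^2$ the limit defining $\mathcal L_\delta Y_\ell^m(\mathbf x)$ exists and $\mathcal L_\delta Y_\ell^m(\mathbf x)=\lambda_\delta(\ell)\,Y_\ell^m(\mathbf x)$. At every $\mathbf x$ for which $\mathbf y\mapsto\rho_\delta(|\mathbf x-\mathbf y|)[Y_\ell^m(\mathbf y)-Y_\ell^m(\mathbf x)]$ is absolutely integrable on $\mathbb S^2$, this identity also holds with $\mathcal L_\delta Y_\ell^m(\mathbf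 x)$ read as an ordinary Lebesgue integral. (ii) Let $-1<\alpha<1$, $0<\delta\le2$, $d=1-\delta^2/2$, and let $\rho_\delta$ be the weakly singular kernel $$\rho_\delta(\sqrt{2(1-t)})=\frac{(1+\alpha)2^{1+\alpha}}{\pi\,\delta^{2+2\alpha}(1-t)^{1-\alpha}}\,\chi_{[0,\delta]}(\sqrt{2(1-t)}).$$ Then $t\mapsto(1-t)\,\rho_\delta(\sqrt{2(1-t)})\in L^1([-1,1])$, so that (i) applies, and the eigenvalue of every $Y_\ell^m$ with $-\ell\le m\le\ell$ is $$\lambda_\delta(\ell)=2\pi\int_d^1[P_\ell(t)-1]\,\rho_\delta(\sqrt{2(1-t)})\,dt=2\pi\int_d^1[P_\ell(t)-1]\,\frac{(1+\alpha)2^{1+\alpha}}{\pi\,\delta^{2+2\alpha}(1-t)^{1-\alpha}}\,dt,$$ the last integral being absolutely convergent. -/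

import Mathlib

open MeasureTheory Set Filter Topology
open scoped Nat Polynomial

noncomputable section

namespace NonlocalSphere

/-- The unit sphere `𝕊²` in `ℝ³`. -/
abbrev Sphere2 : Type := Metric.sphere (0 : EuclideanSpace ℝ (Fin 3)) 1

/-- The standard surface measure `dΩ = sin θ dθ dφ` on `𝕊²` (of total mass `4π`). -/
def surfaceMeasure : Measure Sphere2 :=
  (volume : Measure (EuclideanSpace ℝ (Fin 3))).toSphere

/-- The Legendre polynomial `P_ℓ`, by the formula of Rodrigues:
`P_ℓ = (1 / (2^ℓ ℓ!)) (d/dX)^ℓ (X² - 1)^ℓ`. -/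
def legendreP (l : ℕ) : ℝ[X] :=
  Polynomial.C (1 / ((2 : ℝ) ^ l * (l ! : ℝ))) *
    Polynomial.derivative^[l] ((Polynomial.X ^ 2 - 1) ^ l)

/-- The associated Legendre function of order `m ≥ 0`:
`P_ℓ^m(t) = (-1)^m (1 - t²)^{m/2} P_ℓ^{(m)}(t)`. -/
def assocLegendreNat (l m : ℕ) (t : ℝ) : ℝ :=
  (-1) ^ m * √(1 - t ^ 2) ^ m * (Polynomial.derivative^[m] (legendreP l)).eval t

/-- The associated Legendre function `P_ℓ^m` for `-ℓ ≤ m ≤ ℓ`; for negative orders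
`P_ℓ^{-k} = (-1)^k ((ℓ - k)! / (ℓ + k)!) P_ℓ^k`. -/
def assocLegendre (l : ℕ) (m : ℤ) (t : ℝ) : ℝ :=
  if 0 ≤ m then assocLegendreNat l m.natAbs t
  else (-1) ^ m.natAbs * (((l - m.natAbs)! : ℝ) / ((l + m.natAbs)! : ℝ)) *
    assocLegendreNat l m.natAbs t

/-- The spherical harmonic `Y_ℓ^m` (`-ℓ ≤ m ≤ ℓ`) as a function of the colatitude `θ` and the
longitude `phi`:
`(e^{i m phi} / √(2π)) i^{m+|m|} √((ℓ + 1/2) (ℓ - m)! / (ℓ + m)!) P_ℓ^m(cos θ)`. -/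
def sphericalHarmonicAngles (l : ℕ) (m : ℤ) (θ phi : ℝ) : ℂ :=
  Complex.exp (Complex.I * (m : ℂ) * (phi : ℂ)) / ((√(2 * Real.pi) : ℝ) : ℂ) *
    Complex.I ^ (m + |m|) *
    ((√(((l : ℝ) + 1 / 2) *
        ((((l : ℤ) - m).toNat ! : ℝ) / (((l : ℤ) + m).toNat ! : ℝ))) : ℝ) : ℂ) *
    ((assocLegendre l m (Real.cos θ) : ℝ) : ℂ)

/-- The colatitude of a point of the sphere: `θ ∈ [0, π]` with `cos θ = x₃`. -/
def colatitude (x : Sphere2) : ℝ := Real.arccos (x.1 2)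

/-- The longitude of a point of the sphere, the argument of `x₁ + i x₂`, normalized to
`(-π, π]`; only `e^{i m phi}` with `m ∈ ℤ` is used, so any branch gives the same harmonics. At the
poles its value is irrelevant, since `P_ℓ^m(±1) = 0` for `m ≠ 0`. -/
def longitude (x : Sphere2) : ℝ := Complex.arg ⟨x.1 0, x.1 1⟩

/-- The spherical harmonic `Y_ℓ^m` as a function on the sphere. -/
def sphericalHarmonic (l : ℕ) (m : ℤ) (x : Sphere2) : ℂ :=
  sphericalHarmonicAngles l m (colatitude x) (longitude x)

/-- The integrand `y ↦ ρ(|x - y|) (u(y) - u(x))` of the nonlocal operator; `dist` on the sphere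
is the Euclidean distance in `ℝ³`. -/
def nonlocalIntegrand (ρ : ℝ → ℝ) (u : Sphere2 → ℂ) (x y : Sphere2) : ℂ :=
  (ρ (dist x y) : ℂ) * (u y - u x)

/-- `ℒ u(x)` exists and equals `v`, where
`ℒ u(x) = lim_{ε → 0+} ∫_{|x - y| > ε} ρ(|x - y|) (u(y) - u(x)) dΩ(y)`:
every truncated integral converges absolutely, and they tend to `v`. -/
def HasNonlocalValue (ρ : ℝ → ℝ) (u : Sphere2 → ℂ) (x : Sphere2) (v : ℂ) : Prop :=
  (∀ ε : ℝ, 0 < ε →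
    IntegrableOn (nonlocalIntegrand ρ u x) {y | ε < dist x y} surfaceMeasure) ∧
  Tendsto (fun ε : ℝ => ∫ y in {y | ε < dist x y}, nonlocalIntegrand ρ u x y ∂surfaceMeasure)
    (𝓝[>] 0) (𝓝 v)

/-- `u` is an eigenfunction of the nonlocal operator with kernel `ρ`, with eigenvalue `c`:
`u` is not the zero function, `ℒ u(x) = c u(x)` at every point `x` in the principal value sense,
and also `∫ ρ(|x - y|) (u(y) - u(x)) dΩ(y) = c u(x)` as an ordinary integral at every
point `x` at which that integral converges absolutely. -/
structure IsNonlocalEigenfunction (ρ : ℝ → ℝ) (u : Sphere2 → ℂ) (c : ℝ) : Prop where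
  ne_zero : u ≠ 0
  hasNonlocalValue : ∀ x : Sphere2, HasNonlocalValue ρ u x ((c : ℂ) * u x)
  integral_eq : ∀ x : Sphere2, Integrable (nonlocalIntegrand ρ u x) surfaceMeasure →
    ∫ y, nonlocalIntegrand ρ u x y ∂surfaceMeasure = (c : ℂ) * u x

/-- The condition `t ↦ (1 - t) ρ(√(2(1 - t))) ∈ L¹([-1, 1])` on a kernel. -/
def IsAdmissibleKernel (ρ : ℝ → ℝ) : Prop :=
  IntegrableOn (fun t : ℝ => (1 - t) * ρ √(2 * (1 - t))) (Icc (-1) 1) volume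

/-- `λ(ℓ) = 2π ∫_{-1}^1 (P_ℓ(t) - 1) ρ(√(2(1 - t))) dt`. -/
def nonlocalEigenvalue (ρ : ℝ → ℝ) (l : ℕ) : ℝ :=
  2 * Real.pi * ∫ t in (-1 : ℝ)..1, ((legendreP l).eval t - 1) * ρ √(2 * (1 - t))

/-- The weakly singular kernel with strength `α` and horizon `δ`, as a function of the distance
`r`; with `r = √(2(1 - t))`, that is `r² / 2 = 1 - t`, it reads
`(1 + α) 2^{1+α} / (π δ^{2+2α} (1 - t)^{1-α})` for `r ≤ δ`, and `0` for `r > δ`. -/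
def weaklySingularKernel (α δ r : ℝ) : ℝ :=
  (1 + α) * 2 ^ (1 + α) / (Real.pi * δ ^ (2 + 2 * α) * (r ^ 2 / 2) ^ (1 - α)) *
    (Icc 0 δ).indicator (fun _ => (1 : ℝ)) r

theorem weaklySingularKernel_sqrt (α δ : ℝ) {t : ℝ} (ht : t ≤ 1) :
    weaklySingularKernel α δ √(2 * (1 - t)) =
      (1 + α) * 2 ^ (1 + α) / (Real.pi * δ ^ (2 + 2 * α) * (1 - t) ^ (1 - α)) *
        (Icc 0 δ).indicator (fun _ => (1 : ℝ)) √(2 * (1 - t)) := by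
  unfold weaklySingularKernel
  rw [Real.sq_sqrt (by linarith), mul_div_cancel_left₀ _ (two_ne_zero)]

end NonlocalSphere

end

noncomputable section

namespace NonlocalSphere

/-! This is the Funk–Hecke argument. Rotations about the axis through `x` preserve both the surface
measure and the distance to `x`, so in the integral defining `ℒ u(x)` the value `u y` may be
replaced by its average over such rotations. For a spherical harmonic of degree `l` this average is
`P_l(⟨x, y⟩) u(x)` (`sum_sphericalHarmonic`). What remains depends on `⟨x, y⟩` alone, whose
distribution is `2π dt` on `[-1, 1]` (`measurePreserving_inner`), and the eigenvalue integral
appears (`integral_nonlocalIntegrand`).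

The average needs only `l + 1` rotations and no differential equation. Up to a constant, the
harmonics of degree `l` are the coefficients in `w` of `(z(w) · y)^l`, with `z(w)` a curve of
isotropic vectors in `ℂ³`. Rotating `y` by `θ` about the third axis turns an isotropic linear form
into a Laurent trinomial in `exp(iθ)`. Its `l`-th power has exponents between `-l` and `l`, so
averaging over the `(l + 1)`-th roots of unity leaves the constant term. That term depends only on
the middle coefficient and the product of the outer two, so it can be read off from the Taylor
expansion of `(X² - 1)^l`, which is Rodrigues' formula (`trinomialCoeff_eq_legendre`).

For the principal value, cutting `ρ` off near `0` keeps it admissible and makes the integrand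
absolutely integrable. The formula thus holds for every truncation, and dominated convergence of the
eigenvalue integrals gives the limit. They converge because `P_l(1) = 1` makes `P_l - 1` divisible
by `t - 1`. -/

/-! ### Trinomial coefficients and Legendre polynomials. -/

open Polynomial in
/-- The `n`-th coefficient of `(a + b X + c X²)^l`. -/
def trinomialCoeff {R : Type*} [CommRing R] (a b c : R) (l n : ℕ) : R :=
  ((C a + C b * X + C c * X ^ 2) ^ l).coeff n

-- The power is a polynomial in `X²`, so odd coefficients vanish and even ones come from the
-- binomial theorem.
open Polynomial in
theorem coeff_binomial_sq_pow {R : Type*} [CommRing R] (a c : R) (k : ℕ) :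
    ((C a + C c * X ^ 2) ^ k).coeff k =
      if Even k then (k.choose (k / 2) : R) * (a * c) ^ (k / 2) else 0 := by
  have h : ((C a + C c * X ^ 2) ^ k : R[X]) = expand R 2 ((C a + C c * X) ^ k) := by
    simp
  rw [h, coeff_expand two_pos]
  simp only [even_iff_two_dvd]
  split_ifs with hk
  · obtain ⟨j, rfl⟩ := hk
    rw [Nat.mul_div_cancel_left _ two_pos, add_pow, finsetSum_coeff,
      Finset.sum_eq_single j]
    · have : (C a ^ j * (C c * X) ^ (2 * j - j) * ((2 * j).choose j : R[X])) =
          C (((2 * j).choose j : R) * (a * c) ^ j) * X ^ j := by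
        rw [show 2 * j - j = j by lia]
        simp only [mul_pow, C_mul, C_pow, C_eq_natCast]
        ring
      rw [this, coeff_C_mul_X_pow, if_pos rfl]
    · intro i hi hij
      have : (C a ^ i * (C c * X) ^ (2 * j - i) * ((2 * j).choose i : R[X])) =
          C (((2 * j).choose i : R) * a ^ i * c ^ (2 * j - i)) * X ^ (2 * j - i) := by
        simp only [mul_pow, C_mul, C_pow, C_eq_natCast]
        ring
      rw [this, coeff_C_mul_X_pow, if_neg]
      simp only [Finset.mem_range] at hi
      lia
    · intro h
      simp only [Finset.mem_range] at h
      lia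
  · rfl

open Polynomial in
/-- The central trinomial coefficient depends only on `b` and `a c`. -/
theorem trinomialCoeff_central {R : Type*} [CommRing R] (a b c : R) (l : ℕ) :
    trinomialCoeff a b c l l = ∑ k ∈ Finset.range (l + 1),
      (l.choose k : R) * b ^ (l - k) *
        if Even k then (k.choose (k / 2) : R) * (a * c) ^ (k / 2) else 0 := by
  rw [trinomialCoeff, show (C a + C b * X + C c * X ^ 2 : R[X]) =
    (C a + C c * X ^ 2) + C b * X by ring, add_pow, finsetSum_coeff]
  refine Finset.sum_congr rfl fun k hk => ?_
  have hk' : k ≤ l := by simp only [Finset.mem_range] at hk; lia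
  rw [show (C a + C c * X ^ 2) ^ k * (C b * X) ^ (l - k) * (l.choose k : R[X]) =
      C ((l.choose k : R) * b ^ (l - k)) * ((C a + C c * X ^ 2) ^ k * X ^ (l - k)) by
        simp only [mul_pow, C_mul, C_pow, C_eq_natCast]; ring,
    coeff_C_mul]
  conv_lhs => rw [show l = k + (l - k) by lia]
  rw [show k + (l - k) - k = l - k by lia, coeff_mul_X_pow, coeff_binomial_sq_pow,
    show k + (l - k) = l by lia]

open Polynomial in
theorem trinomialCoeff_rescale {R : Type*} [CommRing R] (a b c w : R) (l n : ℕ) :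
    trinomialCoeff a (b * w) (c * w ^ 2) l n = trinomialCoeff a b c l n * w ^ n := by
  rw [trinomialCoeff, trinomialCoeff, ← comp_C_mul_X_coeff]
  congr 1
  simp
  ring

open Polynomial in
theorem trinomialCoeff_mul_left {R : Type*} [CommRing R] (a b c r : R) (l n : ℕ) :
    trinomialCoeff (r * a) (r * b) (r * c) l n = r ^ l * trinomialCoeff a b c l n := by
  rw [trinomialCoeff, trinomialCoeff, ← coeff_C_mul, C_pow, ← mul_pow]
  congr 2
  simp
  ring

open Polynomial in
theorem map_trinomialCoeff {R S : Type*} [CommRing R] [CommRing S] (f : R →+* S) (a b c : R)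
    (l n : ℕ) : trinomialCoeff (f a) (f b) (f c) l n = f (trinomialCoeff a b c l n) := by
  rw [trinomialCoeff, trinomialCoeff, ← coeff_map]
  simp

open Polynomial in
/-- The coefficients of `(a + b X + a X²)^l` are symmetric. -/
theorem trinomialCoeff_symm {R : Type*} [CommRing R] (a b : R) (l : ℕ) {n : ℕ} (hn : n ≤ 2 * l) :
    trinomialCoeff a b a l n = trinomialCoeff a b a l (2 * l - n) := by
  set A : R[X] := C a + C b * X + C a * X ^ 2 with hA
  have hdeg : A.natDegree ≤ 2 := by
    rw [hA]; compute_degree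
  have hr : reflect 2 A = A := by
    rw [hA, reflect_add, reflect_add, reflect_C_mul_X_pow, reflect_C]
    have : (C b * X : R[X]) = C b * X ^ 1 := by simp
    rw [this, reflect_C_mul_X_pow]
    simp [revAt_le]
    ring
  -- `A` is self-reciprocal of formal degree 2, and reflection is multiplicative.
  have key : ∀ l : ℕ, reflect (2 * l) (A ^ l) = A ^ l := by
    intro l
    induction l with
    | zero => simp [reflect_one]
    | succ l ih =>
      rw [pow_succ, show 2 * (l + 1) = 2 * l + 2 by ring, reflect_mul _ _ _ hdeg, ih, hr]
      exact (natDegree_pow_le_of_le l hdeg).trans (by lia)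
  rw [trinomialCoeff, trinomialCoeff, ← hA]
  conv_lhs => rw [← key l, coeff_reflect, revAt_le hn]

open Polynomial in
/-- Taylor expansion of `(X² - 1)^l` at `t`, in terms of the Legendre polynomial. -/
theorem trinomialCoeff_legendre (l m : ℕ) (t : ℝ) :
    ((l + m)! : ℝ) * trinomialCoeff (t ^ 2 - 1) (2 * t) 1 l (l + m) =
      2 ^ l * (l ! : ℝ) * (derivative^[m] (legendreP l)).eval t := by
  have h1 : (C (t ^ 2 - 1) + C (2 * t) * X + C 1 * X ^ 2 : ℝ[X]) ^ l =
      taylor t ((X ^ 2 - 1) ^ l) := by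
    simp only [taylor_apply, pow_comp, sub_comp, X_comp, one_comp, C_sub, C_mul, C_pow, C_1]
    congr 1
    have : (C 2 : ℝ[X]) = 2 := rfl
    rw [this]
    ring
  have h2 : derivative^[m] (legendreP l) = C (1 / ((2 : ℝ) ^ l * (l ! : ℝ))) *
      derivative^[l + m] ((X ^ 2 - 1) ^ l) := by
    rw [legendreP, iterate_derivative_C_mul, add_comm l m, Function.iterate_add_apply]
  rw [trinomialCoeff, h1, taylor_coeff, h2, ← factorial_smul_hasseDeriv, eval_mul, eval_C]
  have : (l ! : ℝ) ≠ 0 := by positivity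
  rw [LinearMap.smul_apply, eval_smul, nsmul_eq_mul]
  field_simp

theorem ofReal_trinomialCoeff (t : ℝ) (l n : ℕ) :
    ((trinomialCoeff (t ^ 2 - 1) (2 * t) 1 l n : ℝ) : ℂ) =
      trinomialCoeff (R := ℂ) (t ^ 2 - 1) (2 * t) 1 l n := by
  have := map_trinomialCoeff Complex.ofRealHom (t ^ 2 - 1) (2 * t) 1 l n
  simpa using this.symm

/-- Laplace's formula: the constant term of a Laurent trinomial is a Legendre polynomial. -/
theorem trinomialCoeff_eq_legendre (l : ℕ) (t : ℝ) (c β γ : ℂ)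
    (h : 4 * (γ * β) = c ^ 2 * ((t : ℂ) ^ 2 - 1)) :
    trinomialCoeff γ (c * t) β l l = c ^ l * ((legendreP l).eval t : ℝ) := by
  have hl := trinomialCoeff_legendre l 0 t
  have hl0 : (l ! : ℝ) ≠ 0 := by positivity
  have h2 : trinomialCoeff (t ^ 2 - 1) (2 * t) 1 l l = 2 ^ l * (legendreP l).eval t := by
    simp only [add_zero, Function.iterate_zero, id] at hl
    apply mul_left_cancel₀ hl0
    rw [hl]; ring
  -- After scaling, both trinomials have middle coefficient `2ct` and outer product `c²(t² - 1)`, so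
  -- their central coefficients agree.
  have h3 : (2 : ℂ) ^ l * trinomialCoeff γ (c * t) β l l =
      c ^ l * trinomialCoeff (R := ℂ) (t ^ 2 - 1) (2 * t) 1 l l := by
    rw [← trinomialCoeff_mul_left, ← trinomialCoeff_mul_left, trinomialCoeff_central,
      trinomialCoeff_central]
    refine Finset.sum_congr rfl fun k _ => ?_
    rw [show 2 * γ * (2 * β) = 4 * (γ * β) by ring, h,
      show c * ((t : ℂ) ^ 2 - 1) * (c * 1) = c ^ 2 * ((t : ℂ) ^ 2 - 1) by ring,
      show (2 : ℂ) * (c * t) = c * (2 * t) by ring]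
  rw [← ofReal_trinomialCoeff, h2] at h3
  apply mul_left_cancel₀ (pow_ne_zero l (two_ne_zero (α := ℂ)))
  rw [h3]
  push_cast
  ring

/-- At `t = 1` the outer coefficients may be taken to be `0`, and the trinomial degenerates to `X`.
-/
theorem legendreP_eval_one (l : ℕ) : (legendreP l).eval 1 = 1 := by
  have h := trinomialCoeff_eq_legendre l 1 1 0 0 (by simp)
  have h2 : trinomialCoeff (0 : ℂ) (1 * (1 : ℝ)) 0 l l = 1 := by
    simp [trinomialCoeff]
  rw [h2] at h
  simpa using h.symm

open Polynomial in
/-- The associated Legendre functions are trinomial coefficients. -/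
theorem trinomialCoeff_assocLegendre (l m : ℕ) {t : ℝ} (ht : t ^ 2 ≤ 1) :
    ((l + m)! : ℂ) * trinomialCoeff (Complex.I * √(1 - t ^ 2) / 2) (t : ℂ)
        (Complex.I * √(1 - t ^ 2) / 2) l (l + m) =
      Complex.I ^ m * (l ! : ℂ) * (√(1 - t ^ 2) ^ m *
        (derivative^[m] (legendreP l)).eval t : ℝ) := by
  have hss : ((√(1 - t ^ 2) : ℝ) : ℂ) ^ 2 = 1 - (t : ℂ) ^ 2 := by
    rw [← Complex.ofReal_pow, Real.sq_sqrt (by linarith)]; push_cast; ring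
  set s : ℂ := ((√(1 - t ^ 2) : ℝ) : ℂ) with hs
  -- Away from the poles, multiplying the trinomial by `2is` gives `(t² - 1) + 2tX + X²` with `X`
  -- replaced by `isX`. Cancelling `2is` needs `s ≠ 0`, so the poles are treated directly.
  by_cases hs0 : s = 0
  · rcases Nat.eq_zero_or_pos m with rfl | hm
    · have := trinomialCoeff_eq_legendre l t 1 (Complex.I * s / 2) (Complex.I * s / 2)
        (by rw [← neg_sub, ← hss, hs0]; ring)
      rw [one_mul] at this
      simp [this]
    · have h0 : √(1 - t ^ 2) = 0 := Complex.ofReal_eq_zero.1 hs0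
      have h1 : trinomialCoeff (0 : ℂ) (t : ℂ) 0 l (l + m) = 0 := by
        rw [trinomialCoeff]
        have : ((C 0 + C (t : ℂ) * X + C 0 * X ^ 2) ^ l : ℂ[X]) = C ((t : ℂ) ^ l) * X ^ l := by
          simp [mul_pow]
        rw [this, coeff_C_mul_X_pow, if_neg (by lia)]
      rw [hs0, h0, mul_zero, zero_div, h1, zero_pow hm.ne']
      simp
  · have hl := trinomialCoeff_legendre l m t
    have h5 := trinomialCoeff_rescale (R := ℂ) ((t : ℂ) ^ 2 - 1) (2 * t) 1 (Complex.I * s) l (l + m)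
    have h6 := trinomialCoeff_mul_left (Complex.I * s / 2) (t : ℂ) (Complex.I * s / 2)
      (2 * (Complex.I * s)) l (l + m)
    rw [show 2 * (Complex.I * s) * (Complex.I * s / 2) = (t : ℂ) ^ 2 - 1 by
        linear_combination s ^ 2 * Complex.I_sq - hss,
      show 2 * (Complex.I * s) * t = 2 * t * (Complex.I * s) by ring] at h6
    rw [show 1 * (Complex.I * s) ^ 2 = (t : ℂ) ^ 2 - 1 by
        linear_combination s ^ 2 * Complex.I_sq - hss] at h5
    have hc : (((l + m)! : ℝ) : ℂ) * ((trinomialCoeff (t ^ 2 - 1) (2 * t) 1 l (l + m) : ℝ) : ℂ) =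
        2 ^ l * (l ! : ℂ) * (((derivative^[m] (legendreP l)).eval t : ℝ) : ℂ) := by
      exact_mod_cast hl
    have hne : (2 * (Complex.I * s)) ^ l ≠ 0 :=
      pow_ne_zero _ (mul_ne_zero two_ne_zero (mul_ne_zero Complex.I_ne_zero hs0))
    apply mul_left_cancel₀ hne
    have h7 : (2 * (Complex.I * s)) ^ l * trinomialCoeff (Complex.I * s / 2) (t : ℂ)
        (Complex.I * s / 2) l (l + m) =
        trinomialCoeff (R := ℂ) (t ^ 2 - 1) (2 * t) 1 l (l + m) * (Complex.I * s) ^ (l + m) := by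
      rw [← h5, ← h6]
    rw [mul_left_comm, h7, ← ofReal_trinomialCoeff]
    push_cast at hc ⊢
    rw [← hs]
    linear_combination (Complex.I * s) ^ (l + m) * hc

/-! ### Averages of isotropic forms over rotations about an axis. -/

open Polynomial in
/-- Averaging the powers of a Laurent trinomial over roots of unity extracts the constant term. -/
theorem sum_laurentTrinomial_pow (a b c : ℂ) (l : ℕ) {ζ : ℂ} (hζ : IsPrimitiveRoot ζ (l + 1)) :
    ∑ k ∈ Finset.range (l + 1), (a * (ζ ^ k)⁻¹ + b + c * ζ ^ k) ^ l =
      (l + 1 : ℂ) * trinomialCoeff a b c l l := by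
  have hζ0 : ζ ≠ 0 := hζ.ne_zero (by lia)
  have hdeg : ((C a + C b * X + C c * X ^ 2 : ℂ[X]) ^ l).natDegree < 2 * l + 1 := by
    have h2 : (C a + C b * X + C c * X ^ 2 : ℂ[X]).natDegree ≤ 2 := by compute_degree
    exact Nat.lt_succ_of_le ((natDegree_pow_le_of_le l h2).trans (by lia))
  have h1 : ∀ k, (a * (ζ ^ k)⁻¹ + b + c * ζ ^ k) ^ l =
      ∑ n ∈ Finset.range (2 * l + 1), trinomialCoeff a b c l n * (ζ ^ ((n : ℤ) - l)) ^ k := by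
    intro k
    have hk : ζ ^ k ≠ 0 := pow_ne_zero _ hζ0
    have h2 : (a * (ζ ^ k)⁻¹ + b + c * ζ ^ k) ^ l =
        ((C a + C b * X + C c * X ^ 2 : ℂ[X]) ^ l).eval (ζ ^ k) * ((ζ ^ k) ^ l)⁻¹ := by
      rw [← inv_pow (ζ ^ k) l, eval_pow, ← mul_pow]
      congr 1
      simp only [eval_add, eval_mul, eval_C, eval_X, eval_pow]
      field_simp
    rw [h2, eval_eq_sum_range' hdeg, Finset.sum_mul]
    refine Finset.sum_congr rfl fun n _ => ?_
    rw [trinomialCoeff, mul_assoc, zpow_sub₀ hζ0, zpow_natCast, zpow_natCast, div_pow,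
      div_eq_mul_inv, ← pow_mul, ← pow_mul, ← pow_mul, ← pow_mul, mul_comm k, mul_comm k]
  simp only [h1]
  rw [Finset.sum_comm, Finset.sum_eq_single l]
  · simp [mul_comm]
  · intro n hn hnl
    rw [← Finset.mul_sum]
    -- Since `|n - l| ≤ l < l + 1`, the exponent is a multiple of `l + 1` only for `n = l`.
    have h3 : ζ ^ ((n : ℤ) - l) ≠ 1 := by
      rw [Ne, hζ.zpow_eq_one_iff_dvd]
      intro hd
      have := Int.eq_zero_of_abs_lt_dvd hd (by
        simp only [Finset.mem_range] at hn
        rw [abs_lt]; push_cast; lia)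
      lia
    have h4 : (ζ ^ ((n : ℤ) - l)) ^ (l + 1) = 1 := by
      rw [← zpow_natCast, ← zpow_mul, mul_comm, zpow_mul, zpow_natCast, hζ.pow_eq_one, one_zpow]
    rw [geom_sum_eq h3, h4, sub_self, zero_div, mul_zero]
  · intro h
    simp only [Finset.mem_range] at h
    lia

/-- The rotation of `ℝ³` by the angle `θ` about the third axis. -/
def zRotation (θ : ℝ) : EuclideanSpace ℝ (Fin 3) ≃ₗᵢ[ℝ] EuclideanSpace ℝ (Fin 3) :=
  LinearIsometry.toLinearIsometryEquiv
    { toFun := fun y => !₂[Real.cos θ * y 0 - Real.sin θ * y 1,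
        Real.sin θ * y 0 + Real.cos θ * y 1, y 2]
      map_add' := fun y z => by ext i; fin_cases i <;> simp <;> ring
      map_smul' := fun r y => by ext i; fin_cases i <;> simp <;> ring
      norm_map' := fun y => by
        simp only [EuclideanSpace.norm_eq, Fin.sum_univ_three, Real.norm_eq_abs, sq_abs]
        congr 1
        simp
        linear_combination (y 0 ^ 2 + y 1 ^ 2) * Real.sin_sq_add_cos_sq θ } rfl

theorem zRotation_apply (θ : ℝ) (y : EuclideanSpace ℝ (Fin 3)) :
    zRotation θ y = !₂[Real.cos θ * y 0 - Real.sin θ * y 1,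
        Real.sin θ * y 0 + Real.cos θ * y 1, y 2] := rfl

/-- The complex linear form with real part `⟨p, ·⟩` and imaginary part `⟨q, ·⟩`. -/
def complexForm (p q y : EuclideanSpace ℝ (Fin 3)) : ℂ :=
  (inner ℝ p y : ℝ) + Complex.I * (inner ℝ q y : ℝ)

theorem inner_fin_three (p y : EuclideanSpace ℝ (Fin 3)) :
    inner ℝ p y = p 0 * y 0 + p 1 * y 1 + p 2 * y 2 := by
  simp [PiLp.inner_apply, Fin.sum_univ_three, mul_comm]

theorem complexForm_eq (p q y : EuclideanSpace ℝ (Fin 3)) :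
    complexForm p q y = (p 0 + Complex.I * q 0) * y 0 + (p 1 + Complex.I * q 1) * y 1 +
      (p 2 + Complex.I * q 2) * y 2 := by
  rw [complexForm, inner_fin_three, inner_fin_three]
  push_cast
  ring

/-- The conditions on `p`, `q` say that `p + iq = (a, b, c)` is isotropic. On the rotated point the
form equals `A cos θ + B sin θ + c y₂`, a Laurent trinomial in `exp(iθ)` whose outer coefficients
satisfy `4γβ = A² + B² = (a² + b²)(y₀² + y₁²) = c²(y₂² - 1)`. This is what Laplace's formula
requires. -/
theorem sum_complexForm_zRotation {p q y : EuclideanSpace ℝ (Fin 3)} (hpq : ‖p‖ = ‖q‖)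
    (hpq0 : inner ℝ p q = 0) (hy : ‖y‖ = 1) (l : ℕ) :
    ∑ k ∈ Finset.range (l + 1), complexForm p q (zRotation (2 * Real.pi * k / (l + 1)) y) ^ l =
      (l + 1 : ℂ) * ((legendreP l).eval (y 2) : ℝ) * (p 2 + Complex.I * q 2) ^ l := by
  set a : ℂ := p 0 + Complex.I * q 0 with ha
  set b : ℂ := p 1 + Complex.I * q 1 with hb
  set c : ℂ := p 2 + Complex.I * q 2 with hc
  have hiso : a ^ 2 + b ^ 2 + c ^ 2 = 0 := by
    have h1 : inner ℝ p p = inner ℝ q q := by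
      rw [real_inner_self_eq_norm_sq, real_inner_self_eq_norm_sq, hpq]
    rw [inner_fin_three, inner_fin_three] at h1
    rw [inner_fin_three] at hpq0
    have h1c := congrArg (fun r : ℝ => (r : ℂ)) h1
    have h2c := congrArg (fun r : ℝ => (r : ℂ)) hpq0
    simp only at h1c h2c
    push_cast at h1c h2c
    rw [ha, hb, hc]
    linear_combination h1c + 2 * Complex.I * h2c +
      ((q 0 : ℂ) ^ 2 + (q 1 : ℂ) ^ 2 + (q 2 : ℂ) ^ 2) * Complex.I_sq
  have hnorm : (y 0 : ℂ) ^ 2 + (y 1 : ℂ) ^ 2 + (y 2 : ℂ) ^ 2 = 1 := by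
    have h1 : inner ℝ y y = 1 := by rw [real_inner_self_eq_norm_sq, hy]; norm_num
    rw [inner_fin_three] at h1
    have h1c := congrArg (fun r : ℝ => (r : ℂ)) h1
    simp only at h1c
    push_cast at h1c
    linear_combination h1c
  set A : ℂ := a * y 0 + b * y 1 with hA
  set B : ℂ := b * y 0 - a * y 1 with hB
  have hζ := Complex.isPrimitiveRoot_exp (l + 1) (by lia)
  set ζ := Complex.exp (2 * Real.pi * Complex.I / ((l + 1 : ℕ) : ℂ)) with hζdef
  have key := sum_laurentTrinomial_pow ((A + Complex.I * B) / 2) (c * (y 2 : ℝ))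
    ((A - Complex.I * B) / 2) l hζ
  rw [trinomialCoeff_eq_legendre l (y 2) c _ _ (by
    rw [hA, hB]
    linear_combination (y 0 ^ 2 + y 1 ^ 2 : ℂ) * hiso - c ^ 2 * hnorm
      - (b * y 0 - a * y 1) ^ 2 * Complex.I_sq)] at key
  rw [mul_assoc, mul_comm _ (c ^ l), ← key]
  refine Finset.sum_congr rfl fun k _ => ?_
  congr 1
  have hw : ζ ^ k = Complex.exp ((2 * Real.pi * k / (l + 1) : ℝ) * Complex.I) := by
    rw [hζdef, ← Complex.exp_nat_mul]
    congr 1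
    push_cast
    ring
  rw [hw, ← Complex.exp_neg, ← neg_mul, Complex.exp_mul_I, Complex.exp_mul_I, Complex.cos_neg,
    Complex.sin_neg, complexForm_eq, zRotation_apply]
  simp only [← Complex.ofReal_cos, ← Complex.ofReal_sin]
  generalize Real.cos (2 * Real.pi * k / (l + 1)) = C
  generalize Real.sin (2 * Real.pi * k / (l + 1)) = S
  simp only [← ha, ← hb, ← hc]
  simp [hA, hB]
  linear_combination (b * y 0 - a * y 1) * S * Complex.I_sq

/-- Rotations about the axis through `x`, over which isotropic forms have Legendre averages. -/
theorem exists_rotations (x : EuclideanSpace ℝ (Fin 3)) (hx : ‖x‖ = 1) (l : ℕ) :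
    ∃ R : ℕ → EuclideanSpace ℝ (Fin 3) ≃ₗᵢ[ℝ] EuclideanSpace ℝ (Fin 3),
      (∀ k, R k x = x) ∧
      ∀ p q y : EuclideanSpace ℝ (Fin 3), ‖p‖ = ‖q‖ → inner ℝ p q = 0 → ‖y‖ = 1 →
        ∑ k ∈ Finset.range (l + 1), complexForm p q (R k y) ^ l =
          (l + 1 : ℂ) * ((legendreP l).eval (inner ℝ x y) : ℝ) * complexForm p q x ^ l := by
  set e : EuclideanSpace ℝ (Fin 3) := EuclideanSpace.single 2 1 with he
  have hxe : ‖x‖ = ‖e‖ := by simp [he, hx]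
  -- A reflection suffices: conjugating rotations about `e` by `T` gives rotations about `x`. They
  -- depend on neither `p` nor `q`, which later allows coefficients to be compared over a whole
  -- family of forms.
  obtain ⟨T, hT⟩ : ∃ T : EuclideanSpace ℝ (Fin 3) ≃ₗᵢ[ℝ] EuclideanSpace ℝ (Fin 3), T x = e :=
    ⟨_, Submodule.reflection_sub hxe⟩
  have hcoord : ∀ y, T y 2 = inner ℝ x y := by
    intro y
    rw [← T.inner_map_map, hT, he, EuclideanSpace.inner_single_left]
    simp
  have hTs : ∀ p z, inner ℝ p (T.symm z) = inner ℝ (T p) z := by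
    intro p z
    rw [← T.inner_map_map, T.apply_symm_apply]
  refine ⟨fun k => (T.trans (zRotation (2 * Real.pi * k / (l + 1)))).trans T.symm, ?_, ?_⟩
  · intro k
    have : zRotation (2 * Real.pi * k / (l + 1)) e = e := by
      rw [zRotation_apply]
      ext i; fin_cases i <;> simp [he]
    simp only [LinearIsometryEquiv.trans_apply]
    rw [hT, this, ← hT, T.symm_apply_apply]
  · intro p q y hpq hpq0 hy
    have := sum_complexForm_zRotation (p := T p) (q := T q) (y := T y) (by simpa using hpq)
      (by rw [T.inner_map_map, hpq0]) (by simpa using hy) l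
    rw [hcoord, hcoord, hcoord] at this
    rw [complexForm, real_inner_comm x p, real_inner_comm x q, ← this]
    refine Finset.sum_congr rfl fun k _ => ?_
    simp only [LinearIsometryEquiv.trans_apply, complexForm, hTs]

/-! ### Spherical harmonics as coefficients of powers of isotropic forms. -/

/-- The solid harmonic of degree `l` and order `l - n`, up to a constant factor. -/
def solidHarmonic (l n : ℕ) (y : EuclideanSpace ℝ (Fin 3)) : ℂ :=
  trinomialCoeff (Complex.I / 2 * (y 0 + Complex.I * y 1)) (y 2 : ℂ)
    (Complex.I / 2 * (y 0 - Complex.I * y 1)) l n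

-- The generating polynomial `P y` evaluated at `w` is the `l`-th power of the form attached to the
-- isotropic vector `(i(1 + w²)/2, -(1 - w²)/2, w)`. The hypothesis thus gives an identity of
-- polynomials in `w`, whose coefficients yield the claim.
open Polynomial in
theorem sum_solidHarmonic_eq {x y : EuclideanSpace ℝ (Fin 3)} {l : ℕ}
    {R : ℕ → EuclideanSpace ℝ (Fin 3) ≃ₗᵢ[ℝ] EuclideanSpace ℝ (Fin 3)} {r : ℂ}
    (hR : ∀ p q : EuclideanSpace ℝ (Fin 3), ‖p‖ = ‖q‖ → inner ℝ p q = 0 →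
      ∑ k ∈ Finset.range (l + 1), complexForm p q (R k y) ^ l = r * complexForm p q x ^ l)
    (n : ℕ) :
    ∑ k ∈ Finset.range (l + 1), solidHarmonic l n (R k y) = r * solidHarmonic l n x := by
  set P : EuclideanSpace ℝ (Fin 3) → ℂ[X] := fun y =>
    (C (Complex.I / 2 * (y 0 + Complex.I * y 1)) + C (y 2 : ℂ) * X +
      C (Complex.I / 2 * (y 0 - Complex.I * y 1)) * X ^ 2) ^ l with hP
  have key : ∑ k ∈ Finset.range (l + 1), P (R k y) = C r * P x := by
    refine Polynomial.funext fun w => ?_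
    set a : ℂ := Complex.I / 2 * (1 + w ^ 2) with ha
    set b : ℂ := -(1 - w ^ 2) / 2 with hb
    set p : EuclideanSpace ℝ (Fin 3) := !₂[a.re, b.re, w.re] with hp
    set q : EuclideanSpace ℝ (Fin 3) := !₂[a.im, b.im, w.im] with hq
    have hz : ∀ z : ℂ, (z.re : ℂ) + Complex.I * z.im = z := fun z => by
      rw [mul_comm]; exact Complex.re_add_im z
    have hform : ∀ z, (P z).eval w = complexForm p q z ^ l := by
      intro z
      rw [complexForm_eq]
      simp only [hP, eval_add, eval_mul, eval_C, eval_X, eval_pow]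
      congr 1
      have h0 : ((p 0 : ℝ) : ℂ) + Complex.I * (q 0 : ℝ) = a := hz a
      have h1 : ((p 1 : ℝ) : ℂ) + Complex.I * (q 1 : ℝ) = b := hz b
      have h2 : ((p 2 : ℝ) : ℂ) + Complex.I * (q 2 : ℝ) = w := hz w
      rw [h0, h1, h2, ha, hb]
      linear_combination (z 1 : ℂ) / 2 * (1 - w ^ 2) * Complex.I_sq
    have hiso : a ^ 2 + b ^ 2 + w ^ 2 = 0 := by
      rw [ha, hb]
      linear_combination (1 + w ^ 2) ^ 2 / 4 * Complex.I_sq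
    have hre := congrArg Complex.re hiso
    have him := congrArg Complex.im hiso
    simp only [Complex.add_re, Complex.add_im, sq, Complex.mul_re, Complex.mul_im,
      Complex.zero_re, Complex.zero_im] at hre him
    have hpq : ‖p‖ = ‖q‖ := by
      rw [← sq_eq_sq₀ (norm_nonneg _) (norm_nonneg _), ← real_inner_self_eq_norm_sq,
        ← real_inner_self_eq_norm_sq, inner_fin_three, inner_fin_three]
      simp only [hp, hq, PiLp.toLp_apply, Matrix.cons_val]
      linear_combination hre
    have hpq0 : inner ℝ p q = 0 := by
      rw [inner_fin_three]
      simp only [hp, hq, PiLp.toLp_apply, Matrix.cons_val]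
      linear_combination him / 2
    rw [eval_finsetSum, eval_mul, eval_C, hform, ← hR p q hpq hpq0]
    exact Finset.sum_congr rfl fun k _ => hform _
  have := congrArg (fun p => p.coeff n) key
  simp only [finsetSum_coeff, coeff_C_mul] at this
  exact this

open Polynomial in
theorem continuous_solidHarmonic (l n : ℕ) : Continuous (solidHarmonic l n) := by
  unfold solidHarmonic trinomialCoeff
  induction l generalizing n with
  | zero => simpa using continuous_const
  | succ l ih =>
    simp only [pow_succ, coeff_mul]
    refine continuous_finsetSum _ fun ij _ => (ih _).mul ?_
    simp only [← pow_succ, coeff_add, coeff_C, coeff_C_mul, coeff_X, coeff_X_pow]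
    refine ((?_ : Continuous _).add ?_).add ?_
    · split_ifs <;> fun_prop
    · fun_prop
    · fun_prop

theorem assocLegendre_eq (l : ℕ) (m : ℤ) :
    ∃ κ : ℝ, κ ≠ 0 ∧ ∀ t, assocLegendre l m t =
      κ * (√(1 - t ^ 2) ^ m.natAbs *
        (Polynomial.derivative^[m.natAbs] (legendreP l)).eval t) := by
  unfold assocLegendre assocLegendreNat
  split_ifs with h
  · exact ⟨(-1) ^ m.natAbs, by positivity, fun t => by ring⟩
  · refine ⟨(-1) ^ m.natAbs * (((l - m.natAbs)! : ℝ) / ((l + m.natAbs)! : ℝ)) *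
      (-1) ^ m.natAbs, by positivity, fun t => by ring⟩

/-- The longitude enters the outer coefficients as `exp(±i phi)`. Substituting `exp(-i phi) X` for
`X` and factoring out `exp(i phi)^l` removes it. -/
theorem solidHarmonic_polar (l n : ℕ) (y : EuclideanSpace ℝ (Fin 3)) {s phi : ℝ}
    (h : (y 0 : ℂ) + Complex.I * y 1 = s * Complex.exp (Complex.I * phi)) :
    solidHarmonic l n y = Complex.exp (Complex.I * ((l : ℂ) - n) * phi) *
      trinomialCoeff (Complex.I * s / 2) (y 2 : ℂ) (Complex.I * s / 2) l n := by
  have h' : (y 0 : ℂ) - Complex.I * y 1 = s * Complex.exp (-(Complex.I * phi)) := by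
    have := congrArg (starRingEnd ℂ) h
    simp only [map_add, map_mul, Complex.conj_ofReal, Complex.conj_I, ← Complex.exp_conj] at this
    rw [← neg_mul, ← this]
    ring
  have hE : Complex.exp (Complex.I * phi) * Complex.exp (-(Complex.I * phi)) = 1 := by
    rw [← Complex.exp_add, add_neg_cancel, Complex.exp_zero]
  have h1 := trinomialCoeff_mul_left (Complex.I * s / 2)
    ((y 2 : ℂ) * Complex.exp (-(Complex.I * phi)))
    (Complex.I * s / 2 * Complex.exp (-(Complex.I * phi)) ^ 2) (Complex.exp (Complex.I * phi)) l n
  rw [trinomialCoeff_rescale] at h1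
  have h2 : Complex.exp (Complex.I * ((l : ℂ) - n) * phi) =
      Complex.exp (Complex.I * phi) ^ l * Complex.exp (-(Complex.I * phi)) ^ n := by
    rw [← Complex.exp_nat_mul, ← Complex.exp_nat_mul, ← Complex.exp_add]
    congr 1
    ring
  rw [solidHarmonic, h, h', h2, mul_assoc, mul_comm _ (trinomialCoeff _ _ _ _ _), ← h1]
  congr 1
  · ring
  · linear_combination -(y 2 : ℂ) * hE
  · linear_combination -(Complex.I * s / 2) * Complex.exp (-(Complex.I * phi)) * hE

theorem sphere_sum_sq (x : Sphere2) : x.1 0 ^ 2 + x.1 1 ^ 2 + x.1 2 ^ 2 = 1 := by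
  have h1 : inner ℝ x.1 x.1 = 1 := by
    rw [real_inner_self_eq_norm_sq, norm_eq_of_mem_sphere]; norm_num
  rw [inner_fin_three] at h1
  linarith

theorem cos_colatitude (x : Sphere2) : Real.cos (colatitude x) = x.1 2 := by
  have := sphere_sum_sq x
  exact Real.cos_arccos (by nlinarith [sq_nonneg (x.1 0), sq_nonneg (x.1 1)])
    (by nlinarith [sq_nonneg (x.1 0), sq_nonneg (x.1 1)])

theorem exp_longitude (x : Sphere2) :
    (x.1 0 : ℂ) + Complex.I * x.1 1 =
      √(1 - x.1 2 ^ 2) * Complex.exp (Complex.I * longitude x) := by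
  have h := Complex.norm_mul_exp_arg_mul_I ⟨x.1 0, x.1 1⟩
  have hn : ‖(⟨x.1 0, x.1 1⟩ : ℂ)‖ = √(1 - x.1 2 ^ 2) := by
    rw [Complex.norm_def, Complex.normSq_mk]
    congr 1
    linarith [sphere_sum_sq x]
  rw [hn] at h
  rw [longitude, mul_comm Complex.I (Complex.ofReal (Complex.arg _)), h, Complex.mk_eq_add_mul_I,
    mul_comm Complex.I]

theorem sphericalHarmonic_eq_solidHarmonic (l : ℕ) {m : ℤ} (hm : m.natAbs ≤ l) :
    ∃ K : ℂ, ∀ x : Sphere2,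
      sphericalHarmonic l m x = K * solidHarmonic l ((l : ℤ) - m).toNat x.1 := by
  obtain ⟨κ, -, hκ⟩ := assocLegendre_eq l m
  set M := m.natAbs with hM
  set n := ((l : ℤ) - m).toNat with hn
  -- For `m ≥ 0` the index is `n = l - M`, the mirror image of `l + M`; for `m ≤ 0` it is `l + M`
  -- already.
  have hsymm : ∀ a b : ℂ, trinomialCoeff a b a l n = trinomialCoeff a b a l (l + M) := by
    intro a b
    rcases le_total 0 m with h | h
    · rw [trinomialCoeff_symm a b l (n := n) (by lia)]
      congr 1
      lia
    · congr 1
      lia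
  have hnl : ((l : ℂ) - n) = m := by
    have : ((n : ℤ) : ℂ) = (((l : ℤ) - m : ℤ) : ℂ) := by congr 1; lia
    push_cast at this
    rw [this]; ring
  have hI : Complex.I ^ M * (l ! : ℂ) ≠ 0 :=
    mul_ne_zero (pow_ne_zero _ Complex.I_ne_zero) (by exact_mod_cast l.factorial_ne_zero)
  refine ⟨1 / ((√(2 * Real.pi) : ℝ) : ℂ) * Complex.I ^ (m + |m|) *
    ((√(((l : ℝ) + 1 / 2) *
        ((((l : ℤ) - m).toNat ! : ℝ) / (((l : ℤ) + m).toNat ! : ℝ))) : ℝ) : ℂ) *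
    (κ * (((l + M)! : ℂ) / (Complex.I ^ M * (l ! : ℂ)))), fun x => ?_⟩
  have ht : x.1 2 ^ 2 ≤ 1 := by nlinarith [sphere_sum_sq x, sq_nonneg (x.1 0), sq_nonneg (x.1 1)]
  have h1 := trinomialCoeff_assocLegendre l M ht
  have h2 : (((l + M)! : ℂ) / (Complex.I ^ M * (l ! : ℂ))) *
      trinomialCoeff (Complex.I * √(1 - x.1 2 ^ 2) / 2) (x.1 2 : ℂ)
        (Complex.I * √(1 - x.1 2 ^ 2) / 2) l (l + M) =
      (√(1 - x.1 2 ^ 2) ^ M *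
        (Polynomial.derivative^[M] (legendreP l)).eval (x.1 2) : ℝ) := by
    rw [div_mul_eq_mul_div, h1, mul_div_cancel_left₀ _ hI]
  rw [solidHarmonic_polar l n x.1 (exp_longitude x), hsymm, hnl, sphericalHarmonic,
    sphericalHarmonicAngles, cos_colatitude, hκ, Complex.ofReal_mul κ, ← h2]
  ring

/-- The monic polynomial `(X² - 1)^l` of degree `2l` is differentiated `l + m ≤ 2l` times, so its
leading term survives. -/
theorem iterate_derivative_legendreP_ne_zero {l m : ℕ} (hm : m ≤ l) :
    Polynomial.derivative^[m] (legendreP l) ≠ 0 := by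
  have h2 : Polynomial.derivative^[m] (legendreP l) =
      Polynomial.C (1 / ((2 : ℝ) ^ l * (l ! : ℝ))) *
      Polynomial.derivative^[l + m] ((Polynomial.X ^ 2 - 1) ^ l) := by
    rw [legendreP, Polynomial.iterate_derivative_C_mul, add_comm l m, Function.iterate_add_apply]
  have hmon : (Polynomial.X ^ 2 - 1 : ℝ[X]).Monic := by
    simpa using Polynomial.monic_X_pow_sub_C (1 : ℝ) two_ne_zero
  have hdeg : ((Polynomial.X ^ 2 - 1 : ℝ[X]) ^ l).natDegree = l - m + (l + m) := by
    have : (Polynomial.X ^ 2 - 1 : ℝ[X]).natDegree = 2 := by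
      simpa using Polynomial.natDegree_X_pow_sub_C (n := 2) (r := (1 : ℝ))
    rw [hmon.natDegree_pow, this]; lia
  have hl : (l ! : ℝ) ≠ 0 := by positivity
  rw [h2]
  refine mul_ne_zero (by simp [hl]) fun h0 => ?_
  have h3 := congrArg (fun p => p.coeff (l - m)) h0
  simp only [Polynomial.coeff_iterate_derivative, Polynomial.coeff_zero] at h3
  rw [← hdeg, Polynomial.coeff_natDegree, (hmon.pow l).leadingCoeff, hdeg, nsmul_one,
    Nat.cast_eq_zero, Nat.descFactorial_eq_zero_iff_lt] at h3
  lia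

theorem sphericalHarmonic_ne_zero (l : ℕ) {m : ℤ} (hm : m.natAbs ≤ l) :
    sphericalHarmonic l m ≠ 0 := by
  obtain ⟨κ, hκ0, hκ⟩ := assocLegendre_eq l m
  -- A height strictly between the poles that avoids the finitely many zeros of the derivative.
  obtain ⟨t, ht, htr⟩ := (Ioo_infinite (show (-1 : ℝ) < 1 by norm_num)).exists_notMem_finset
    (Polynomial.derivative^[m.natAbs] (legendreP l)).roots.toFinset
  rw [Multiset.mem_toFinset, Polynomial.mem_roots (iterate_derivative_legendreP_ne_zero hm)] at htr
  have hs : 0 < 1 - t ^ 2 := by nlinarith [ht.1, ht.2]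
  have hx : !₂[√(1 - t ^ 2), 0, t] ∈ Metric.sphere (0 : EuclideanSpace ℝ (Fin 3)) 1 := by
    rw [mem_sphere_zero_iff_norm, EuclideanSpace.norm_eq, Fin.sum_univ_three]
    simp [Real.sq_sqrt hs.le]
  intro h0
  have h1 := congrFun h0 ⟨_, hx⟩
  rw [sphericalHarmonic, sphericalHarmonicAngles, cos_colatitude] at h1
  have h2 : assocLegendre l m t ≠ 0 := by
    rw [hκ]
    exact mul_ne_zero hκ0 (mul_ne_zero (pow_ne_zero _ (Real.sqrt_pos.2 hs).ne') htr)
  have h3 : √(((l : ℝ) + 1 / 2) *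
      ((((l : ℤ) - m).toNat ! : ℝ) / (((l : ℤ) + m).toNat ! : ℝ))) ≠ 0 := by positivity
  have h4 : √(2 * Real.pi) ≠ 0 := by positivity
  have h5 : Complex.I ^ (m + |m|) ≠ 0 := zpow_ne_zero _ Complex.I_ne_zero
  simp only [Pi.zero_apply, mul_eq_zero, div_eq_zero_iff, Complex.ofReal_eq_zero,
    Complex.exp_ne_zero, false_or, h3, h4, h5] at h1
  exact h2 h1

/-! ### The surface measure: invariance under isometries and the distribution of heights. -/

/-- The map of the unit sphere to itself induced by a linear isometry. -/
def sphereMap (T : EuclideanSpace ℝ (Fin 3) ≃ₗᵢ[ℝ] EuclideanSpace ℝ (Fin 3)) (y : Sphere2) :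
    Sphere2 :=
  ⟨T y.1, by simp⟩

/-- `toSphere` measures a set by the volume of the cone over it. Linear isometries carry cones to
cones and preserve volume. -/
theorem measurePreserving_sphereMap
    (T : EuclideanSpace ℝ (Fin 3) ≃ₗᵢ[ℝ] EuclideanSpace ℝ (Fin 3)) :
    MeasurePreserving (sphereMap T) surfaceMeasure surfaceMeasure := by
  have hm : Measurable (sphereMap T) :=
    (Continuous.subtype_mk (T.continuous.comp continuous_subtype_val) _).measurable
  refine ⟨hm, Measure.ext fun s hs => ?_⟩
  rw [Measure.map_apply hm hs, surfaceMeasure, Measure.toSphere_apply' _ (hm hs),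
    Measure.toSphere_apply' _ hs]
  conv_rhs => rw [← T.measurePreserving.measure_preimage_emb T.toHomeomorph.measurableEmbedding]
  congr 2
  ext z
  simp only [Set.mem_smul, Set.mem_image, Set.mem_preimage, Subtype.exists, exists_and_right,
    exists_eq_right]
  constructor
  · rintro ⟨r, hr, y, ⟨hy, hys⟩, rfl⟩
    exact ⟨r, hr, T y, ⟨by simpa using hy, hys⟩, by simp⟩
  · rintro ⟨r, hr, y, ⟨hy, hys⟩, h⟩
    refine ⟨r, hr, T.symm y, ⟨by simpa using hy, ?_⟩, ?_⟩
    · simpa [sphereMap] using hys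
    · rw [← T.symm_apply_apply z, ← h]
      simp

theorem measurePreserving_splitThird :
    MeasurePreserving (fun y : EuclideanSpace ℝ (Fin 3) => ((y 2, (y 0, y 1)) : ℝ × ℝ × ℝ)) := by
  have h1 := PiLp.volume_preserving_ofLp (Fin 3)
  have h2 := volume_preserving_piFinSuccAbove (fun _ : Fin 3 => ℝ) 2
  have h3 := (MeasurePreserving.id (volume : Measure ℝ)).prod (volume_preserving_finTwoArrow ℝ)
  exact h3.comp (h2.comp h1)

theorem lintegral_sq_add_sq {F : ℝ → ENNReal} (hF : Measurable F) :
    ∫⁻ p : ℝ × ℝ, F (√(p.1 ^ 2 + p.2 ^ 2)) =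
      ENNReal.ofReal (2 * Real.pi) * ∫⁻ r in Ioi 0, ENNReal.ofReal r * F r := by
  rw [← lintegral_comp_polarCoord_symm, polarCoord_target]
  have h1 : ∀ p ∈ (Ioi (0 : ℝ)) ×ˢ Ioo (-Real.pi) Real.pi,
      ENNReal.ofReal p.1 • F (√((polarCoord.symm p).1 ^ 2 + (polarCoord.symm p).2 ^ 2)) =
        ENNReal.ofReal p.1 * F p.1 := by
    intro p hp
    have h0 : (p.1 * Real.cos p.2) ^ 2 + (p.1 * Real.sin p.2) ^ 2 = p.1 ^ 2 := by
      linear_combination p.1 ^ 2 * Real.sin_sq_add_cos_sq p.2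
    rw [polarCoord_symm_apply, smul_eq_mul]
    simp only [h0]
    rw [Real.sqrt_sq (le_of_lt hp.1)]
  rw [setLIntegral_congr_fun (measurableSet_Ioi.prod measurableSet_Ioo) h1, Measure.volume_eq_prod,
    ← Measure.prod_restrict, lintegral_prod _ (by fun_prop)]
  simp only [lintegral_const, Measure.restrict_apply_univ, Real.volume_Ioo]
  rw [lintegral_mul_const _ (by fun_prop), mul_comm]
  congr 2
  ring

/-- Polar coordinates in the meridian half-plane of height `z` and distance `r` from the axis: `r >
0` singles out the angles in `(0, π)`. -/
theorem lintegral_upper_half_plane {H : ℝ × ℝ → ENNReal} (hH : Measurable H) :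
    ∫⁻ z, ∫⁻ r in Ioi 0, H (z, r) = ∫⁻ ρ in Ioi (0 : ℝ), ∫⁻ θ in Ioo 0 Real.pi,
      ENNReal.ofReal ρ * H (ρ * Real.cos θ, ρ * Real.sin θ) := by
  have h1 : ∫⁻ z, ∫⁻ r in Ioi 0, H (z, r) =
      ∫⁻ p : ℝ × ℝ, (univ ×ˢ Ioi (0 : ℝ)).indicator H p := by
    rw [lintegral_indicator (MeasurableSet.univ.prod measurableSet_Ioi), Measure.volume_eq_prod,
      ← Measure.prod_restrict, lintegral_prod _ (by fun_prop), Measure.restrict_univ]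
  have hind : Measurable ((univ ×ˢ Ioi (0 : ℝ)).indicator H) :=
    hH.indicator (MeasurableSet.univ.prod measurableSet_Ioi)
  rw [h1, ← lintegral_comp_polarCoord_symm, polarCoord_target, Measure.volume_eq_prod,
    ← Measure.prod_restrict]
  simp only [polarCoord_symm_apply, smul_eq_mul]
  rw [lintegral_prod _ (by fun_prop)]
  refine setLIntegral_congr_fun measurableSet_Ioi fun ρ hρ => ?_
  have h2 : Ioo (0 : ℝ) Real.pi ⊆ Ioo (-Real.pi) Real.pi :=
    Ioo_subset_Ioo (by linarith [Real.pi_pos]) le_rfl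
  simp only
  rw [← inter_eq_self_of_subset_left h2, ← setLIntegral_indicator measurableSet_Ioo]
  refine setLIntegral_congr_fun measurableSet_Ioo fun θ hθ => ?_
  have hρ' : 0 < ρ := hρ
  by_cases h : 0 < θ
  · have hs : 0 < Real.sin θ := Real.sin_pos_of_pos_of_lt_pi h hθ.2
    rw [indicator_of_mem, indicator_of_mem]
    · exact ⟨h, hθ.2⟩
    · exact ⟨mem_univ _, mul_pos hρ' hs⟩
  · have hs : Real.sin θ ≤ 0 := Real.sin_nonpos_of_nonpos_of_neg_pi_le (not_lt.1 h) hθ.1.le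
    rw [indicator_of_notMem, indicator_of_notMem, mul_zero]
    · exact fun h' => h h'.1
    · exact fun h' => absurd h'.2 (not_lt.2 (mul_nonpos_of_nonneg_of_nonpos hρ'.le hs))

/-- Integration of an axially symmetric function over `ℝ³` in spherical coordinates. -/
theorem lintegral_axial {F : ℝ × ℝ → ENNReal} (hF : Measurable F) :
    ∫⁻ y : EuclideanSpace ℝ (Fin 3), F (y 2, √(y 0 ^ 2 + y 1 ^ 2)) =
      ENNReal.ofReal (2 * Real.pi) * ∫⁻ ρ in Ioi (0 : ℝ), ∫⁻ θ in Ioo 0 Real.pi,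
        ENNReal.ofReal ρ * (ENNReal.ofReal (ρ * Real.sin θ) *
          F (ρ * Real.cos θ, ρ * Real.sin θ)) := by
  have h1 := measurePreserving_splitThird.lintegral_comp
    (f := fun p : ℝ × ℝ × ℝ => F (p.1, √(p.2.1 ^ 2 + p.2.2 ^ 2))) (by fun_prop)
  rw [h1, Measure.volume_eq_prod, lintegral_prod _ (by fun_prop)]
  have h2 : ∀ z, ∫⁻ p : ℝ × ℝ, F (z, √(p.1 ^ 2 + p.2 ^ 2)) =
      ENNReal.ofReal (2 * Real.pi) * ∫⁻ r in Ioi 0, ENNReal.ofReal r * F (z, r) := fun z =>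
    lintegral_sq_add_sq (F := fun r => F (z, r)) (by fun_prop)
  simp only [h2]
  have hm : Measurable fun p : ℝ × ℝ => ENNReal.ofReal p.2 * F p := by fun_prop
  rw [lintegral_const_mul _ (Measurable.lintegral_prod_right hm),
    lintegral_upper_half_plane hm]

theorem lintegral_sin_mul_cos (g : ℝ → ENNReal) :
    ∫⁻ θ in Ioo 0 Real.pi, ENNReal.ofReal (Real.sin θ) * g (Real.cos θ) =
      ∫⁻ t in Ioo (-1) 1, g t := by
  have himg : Real.cos '' Ioo 0 Real.pi = Ioo (-1) 1 := by
    ext t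
    constructor
    · rintro ⟨θ, hθ, rfl⟩
      constructor
      · rw [← Real.cos_pi]
        exact Real.strictAntiOn_cos ⟨hθ.1.le, hθ.2.le⟩ ⟨Real.pi_pos.le, le_rfl⟩ hθ.2
      · rw [← Real.cos_zero]
        exact Real.strictAntiOn_cos ⟨le_rfl, Real.pi_pos.le⟩ ⟨hθ.1.le, hθ.2.le⟩ hθ.1
    · intro ht
      refine ⟨Real.arccos t, ⟨Real.arccos_pos.2 ht.2, ?_⟩, Real.cos_arccos ht.1.le ht.2.le⟩
      exact lt_of_le_of_ne (Real.arccos_le_pi t) fun h => absurd (Real.arccos_eq_pi.1 h)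
        (not_le.2 ht.1)
  rw [← himg, lintegral_image_eq_lintegral_abs_deriv_mul measurableSet_Ioo
    (fun θ _ => (Real.hasDerivAt_cos θ).hasDerivWithinAt)
    (Real.injOn_cos.mono Ioo_subset_Icc_self)]
  refine setLIntegral_congr_fun measurableSet_Ioo fun θ hθ => ?_
  rw [abs_neg, abs_of_pos (Real.sin_pos_of_pos_of_lt_pi hθ.1 hθ.2)]

theorem lintegral_Ioi_indicator_sq :
    ∫⁻ ρ in Ioi (0 : ℝ), (Iio (1 : ℝ)).indicator (fun ρ => ENNReal.ofReal (ρ ^ 2)) ρ = 3⁻¹ := by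
  rw [setLIntegral_indicator measurableSet_Iio, inter_comm, Ioi_inter_Iio,
    Measure.restrict_congr_set Ioo_ae_eq_Ioc, ← ofReal_integral_eq_lintegral_ofReal
      (intervalIntegral.intervalIntegrable_pow 2).1,
    ← intervalIntegral.integral_of_le zero_le_one]
  · rw [integral_pow]
    norm_num
    rw [one_div, ENNReal.ofReal_inv_of_pos (by norm_num)]
    norm_num
  · filter_upwards with ρ using sq_nonneg ρ

open scoped Pointwise in
theorem cone_eq (A : Set ℝ) :
    Ioo (0 : ℝ) 1 • ((↑) '' {y : Sphere2 | y.1 2 ∈ A} : Set (EuclideanSpace ℝ (Fin 3))) =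
      {z | ‖z‖ ∈ Ioo (0 : ℝ) 1 ∧ z 2 / ‖z‖ ∈ A} := by
  ext z
  simp only [Set.mem_smul, Set.mem_image, Set.mem_ofPred_eq, Subtype.exists, exists_and_right,
    exists_eq_right]
  constructor
  · rintro ⟨r, hr, y, ⟨hy, hys⟩, rfl⟩
    have hn : ‖r • y‖ = r := by
      rw [norm_smul, mem_sphere_zero_iff_norm.1 hy, mul_one, Real.norm_of_nonneg hr.1.le]
    rw [hn]
    refine ⟨hr, ?_⟩
    simpa [hr.1.ne'] using hys
  · rintro ⟨hz, hA⟩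
    have hz0 : ‖z‖ ≠ 0 := hz.1.ne'
    refine ⟨‖z‖, hz, ‖z‖⁻¹ • z, ⟨?_, ?_⟩, ?_⟩
    · rw [mem_sphere_zero_iff_norm, norm_smul, norm_inv, norm_norm, inv_mul_cancel₀ hz0]
    · simpa [div_eq_inv_mul] using hA
    · rw [smul_smul, mul_inv_cancel₀ hz0, one_smul]

/-- Archimedes' theorem: the height on the sphere is uniformly distributed. -/
theorem measurePreserving_height :
    MeasurePreserving (fun y : Sphere2 => y.1 2) surfaceMeasure
      (ENNReal.ofReal (2 * Real.pi) • volume.restrict (Icc (-1) 1)) := by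
  have hm : Measurable fun y : Sphere2 => y.1 2 := by fun_prop
  refine ⟨hm, Measure.ext fun (A : Set ℝ) hA => ?_⟩
  rw [Measure.map_apply hm hA, surfaceMeasure, Measure.toSphere_apply' _ (hm hA)]
  have hpre : (fun y : Sphere2 => y.1 2) ⁻¹' A = {y : Sphere2 | y.1 2 ∈ A} := rfl
  rw [hpre, cone_eq]
  set F : ℝ × ℝ → ENNReal := fun p =>
    (Ioo (0 : ℝ) 1).indicator 1 (√(p.1 ^ 2 + p.2 ^ 2)) *
      A.indicator 1 (p.1 / √(p.1 ^ 2 + p.2 ^ 2)) with hF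
  have hFm : Measurable F := by
    refine Measurable.mul ?_ ?_
    · exact (measurable_one.indicator measurableSet_Ioo).comp (by fun_prop)
    · exact (measurable_one.indicator hA).comp (by fun_prop)
  have hset : MeasurableSet {z : EuclideanSpace ℝ (Fin 3) | ‖z‖ ∈ Ioo (0 : ℝ) 1 ∧
      z 2 / ‖z‖ ∈ A} := by
    refine MeasurableSet.inter (measurable_norm measurableSet_Ioo) ?_
    have : Measurable fun z : EuclideanSpace ℝ (Fin 3) => z 2 / ‖z‖ := by fun_prop
    exact this hA
  have h1 : volume {z : EuclideanSpace ℝ (Fin 3) | ‖z‖ ∈ Ioo (0 : ℝ) 1 ∧ z 2 / ‖z‖ ∈ A} =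
      ∫⁻ y : EuclideanSpace ℝ (Fin 3), F (y 2, √(y 0 ^ 2 + y 1 ^ 2)) := by
    rw [← lintegral_indicator_one hset]
    refine lintegral_congr fun z => ?_
    have hn : √(z 2 ^ 2 + √(z 0 ^ 2 + z 1 ^ 2) ^ 2) = ‖z‖ := by
      rw [Real.sq_sqrt (by positivity), EuclideanSpace.norm_eq, Fin.sum_univ_three]
      simp only [Real.norm_eq_abs, sq_abs]
      congr 1; ring
    simp only [hF, hn]
    by_cases h : ‖z‖ ∈ Ioo (0 : ℝ) 1
    · by_cases h' : z 2 / ‖z‖ ∈ A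
      · rw [indicator_of_mem h, indicator_of_mem h', indicator_of_mem]
        · simp
        · exact ⟨h, h'⟩
      · rw [indicator_of_notMem h', indicator_of_notMem fun hz => h' hz.2, mul_zero]
    · rw [indicator_of_notMem h, indicator_of_notMem fun hz => h hz.1, zero_mul]
  have h2 : ∀ ρ ∈ Ioi (0 : ℝ), (∫⁻ θ in Ioo 0 Real.pi, ENNReal.ofReal ρ *
      (ENNReal.ofReal (ρ * Real.sin θ) * F (ρ * Real.cos θ, ρ * Real.sin θ))) =
      (Iio (1 : ℝ)).indicator (fun ρ => ENNReal.ofReal (ρ ^ 2)) ρ *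
        ∫⁻ t in Ioo (-1) 1, A.indicator 1 t := by
    intro ρ hρ
    have hρ' : 0 < ρ := hρ
    rw [← lintegral_sin_mul_cos, ← lintegral_const_mul'']
    · refine lintegral_congr fun θ => ?_
      have hn : √((ρ * Real.cos θ) ^ 2 + (ρ * Real.sin θ) ^ 2) = ρ := by
        rw [show (ρ * Real.cos θ) ^ 2 + (ρ * Real.sin θ) ^ 2 = ρ ^ 2 by
          linear_combination ρ ^ 2 * Real.sin_sq_add_cos_sq θ, Real.sqrt_sq hρ'.le]
      simp only [hF, hn, mul_div_cancel_left₀ _ hρ'.ne']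
      rw [ENNReal.ofReal_mul hρ'.le]
      by_cases h1 : ρ < 1
      · rw [indicator_of_mem (show ρ ∈ Ioo 0 1 from ⟨hρ', h1⟩),
          indicator_of_mem (show ρ ∈ Iio 1 from h1), sq, ENNReal.ofReal_mul hρ'.le, Pi.one_apply]
        ring
      · rw [indicator_of_notMem (fun h : ρ ∈ Ioo 0 1 => h1 h.2),
          indicator_of_notMem (fun h : ρ ∈ Iio 1 => h1 h)]
        simp
    · refine Measurable.aemeasurable (Measurable.mul (by fun_prop) ?_)
      exact (measurable_one.indicator hA).comp Real.measurable_cos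
  rw [h1, lintegral_axial hFm, setLIntegral_congr_fun measurableSet_Ioi h2, lintegral_mul_const,
    lintegral_Ioi_indicator_sq, lintegral_indicator_one hA, finrank_euclideanSpace_fin]
  -- The dimension factor `3` in `toSphere` cancels the radial integral `∫₀¹ ρ² dρ = 1/3`.
  · rw [Measure.smul_apply, smul_eq_mul, Measure.restrict_congr_set Ioo_ae_eq_Icc, Nat.cast_ofNat,
      mul_left_comm, ← mul_assoc 3, ENNReal.mul_inv_cancel (by norm_num) (by norm_num), one_mul]
  · exact (by fun_prop : Measurable fun ρ : ℝ => ENNReal.ofReal (ρ ^ 2)).indicator measurableSet_Iio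

theorem measurePreserving_inner (x : Sphere2) :
    MeasurePreserving (fun y : Sphere2 => (inner ℝ x.1 y.1 : ℝ)) surfaceMeasure
      (ENNReal.ofReal (2 * Real.pi) • volume.restrict (Icc (-1) 1)) := by
  set e : EuclideanSpace ℝ (Fin 3) := EuclideanSpace.single 2 1 with he
  have hxe : ‖x.1‖ = ‖e‖ := by simp [he]
  obtain ⟨T, hT⟩ : ∃ T : EuclideanSpace ℝ (Fin 3) ≃ₗᵢ[ℝ] EuclideanSpace ℝ (Fin 3), T x.1 = e :=
    ⟨_, Submodule.reflection_sub hxe⟩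
  have hcoord : (fun y : Sphere2 => (inner ℝ x.1 y.1 : ℝ)) =
      (fun y : Sphere2 => y.1 2) ∘ sphereMap T := by
    funext y
    rw [← T.inner_map_map, hT, he, EuclideanSpace.inner_single_left]
    simp [sphereMap]
  rw [hcoord]
  exact measurePreserving_height.comp (measurePreserving_sphereMap T)

/-! ### The Funk–Hecke formula. -/

theorem dist_eq_sqrt_inner (x y : Sphere2) :
    dist x y = √(2 * (1 - inner ℝ x.1 y.1)) := by
  have h := norm_sub_sq_real x.1 y.1
  rw [norm_eq_of_mem_sphere, norm_eq_of_mem_sphere] at h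
  rw [Subtype.dist_eq, dist_eq_norm, ← Real.sqrt_sq (norm_nonneg (x.1 - y.1)), h]
  congr 1
  ring

theorem dist_sphereMap_of_fixed {T : EuclideanSpace ℝ (Fin 3) ≃ₗᵢ[ℝ] EuclideanSpace ℝ (Fin 3)}
    {x : Sphere2} (hT : T x.1 = x.1) (y : Sphere2) : dist x (sphereMap T y) = dist x y := by
  rw [Subtype.dist_eq, Subtype.dist_eq]
  conv_lhs => rw [← hT]
  exact T.dist_map _ _

/-- Since `P_l(1) = 1`, the factor `P_l - 1` is `(t - 1) Q` with `Q` bounded on `[-1, 1]`, and `(1 -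
t) ρ` is integrable by assumption. -/
theorem integrableOn_legendre_sub_one_mul {ρ : ℝ → ℝ} (hρ : IsAdmissibleKernel ρ) (l : ℕ) :
    IntegrableOn (fun t : ℝ => ((legendreP l).eval t - 1) * ρ √(2 * (1 - t))) (Icc (-1) 1) := by
  obtain ⟨Q, hQ⟩ : Polynomial.X - Polynomial.C 1 ∣ legendreP l - 1 := by
    rw [Polynomial.dvd_iff_isRoot]
    simp [legendreP_eval_one]
  have h : (fun t : ℝ => ((legendreP l).eval t - 1) * ρ √(2 * (1 - t))) =
      fun t => -Q.eval t * ((1 - t) * ρ √(2 * (1 - t))) := by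
    funext t
    have := congrArg (Polynomial.eval t) hQ
    simp only [Polynomial.eval_sub, Polynomial.eval_mul, Polynomial.eval_one, Polynomial.eval_X,
      Polynomial.eval_C] at this
    rw [this]; ring
  rw [h]
  exact IntegrableOn.continuousOn_mul Q.continuous.neg.continuousOn hρ isCompact_Icc

theorem intervalIntegrable_legendre_sub_one_mul {ρ : ℝ → ℝ} (hρ : IsAdmissibleKernel ρ) (l : ℕ) :
    IntervalIntegrable (fun t : ℝ => ((legendreP l).eval t - 1) * ρ √(2 * (1 - t)))
      volume (-1) 1 :=
  (intervalIntegrable_iff_integrableOn_Icc_of_le (by norm_num)).2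
    (integrableOn_legendre_sub_one_mul hρ l)

theorem sum_sphericalHarmonic {l : ℕ} {m : ℤ} (hm : m.natAbs ≤ l) (x : Sphere2) :
    ∃ R : ℕ → EuclideanSpace ℝ (Fin 3) ≃ₗᵢ[ℝ] EuclideanSpace ℝ (Fin 3),
      (∀ k, R k x.1 = x.1) ∧
      ∀ y, ∑ k ∈ Finset.range (l + 1), sphericalHarmonic l m (sphereMap (R k) y) =
        (l + 1 : ℂ) * ((legendreP l).eval (inner ℝ x.1 y.1) : ℝ) * sphericalHarmonic l m x := by
  obtain ⟨R, hRx, hR⟩ := exists_rotations x.1 (by simp) l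
  obtain ⟨K, hK⟩ := sphericalHarmonic_eq_solidHarmonic l hm
  refine ⟨R, hRx, fun y => ?_⟩
  have := sum_solidHarmonic_eq (fun p q hpq hpq0 => hR p q y.1 hpq hpq0 (by simp))
    ((l : ℤ) - m).toNat
  simp only [hK, sphereMap, ← Finset.mul_sum]
  rw [this]
  ring

/-- The Funk-Hecke formula, in the form needed for nonlocal operators. -/
theorem integral_nonlocalIntegrand {ρ : ℝ → ℝ} (hρ : IsAdmissibleKernel ρ) {l : ℕ} {m : ℤ}
    (hm : m.natAbs ≤ l) (x : Sphere2)
    (hint : Integrable (nonlocalIntegrand ρ (sphericalHarmonic l m) x) surfaceMeasure) :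
    ∫ y, nonlocalIntegrand ρ (sphericalHarmonic l m) x y ∂surfaceMeasure =
      (nonlocalEigenvalue ρ l : ℂ) * sphericalHarmonic l m x := by
  obtain ⟨R, hRx, hR⟩ := sum_sphericalHarmonic hm x
  set u := sphericalHarmonic l m with hu
  set g : ℝ → ℝ := fun t => ((legendreP l).eval t - 1) * ρ √(2 * (1 - t)) with hg
  have hmp := fun k => measurePreserving_sphereMap (R k)
  have h1 : ∀ k, ∫ y, nonlocalIntegrand ρ u x (sphereMap (R k) y) ∂surfaceMeasure =
      ∫ y, nonlocalIntegrand ρ u x y ∂surfaceMeasure := by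
    intro k
    have := integral_map (hmp k).measurable.aemeasurable
      (by rw [(hmp k).map_eq]; exact hint.aestronglyMeasurable)
    rw [← this, (hmp k).map_eq]
  -- The rotations fix `x`, so the kernel is a common factor and only `u` is averaged.
  have h2 : ∀ y, ∑ k ∈ Finset.range (l + 1), nonlocalIntegrand ρ u x (sphereMap (R k) y) =
      (l + 1 : ℂ) * ((g (inner ℝ x.1 y.1) : ℝ) * u x) := by
    intro y
    simp only [nonlocalIntegrand, dist_sphereMap_of_fixed (hRx _), ← Finset.mul_sum,
      Finset.sum_sub_distrib, hR y, Finset.sum_const, Finset.card_range, hg]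
    rw [dist_eq_sqrt_inner]
    push_cast
    simp only [nsmul_eq_mul]
    push_cast
    ring
  have h3 : ∫ y, ∑ k ∈ Finset.range (l + 1), nonlocalIntegrand ρ u x (sphereMap (R k) y)
      ∂surfaceMeasure = (l + 1 : ℂ) * ∫ y, nonlocalIntegrand ρ u x y ∂surfaceMeasure := by
    refine (integral_finsetSum _ fun k _ => (hmp k).integrable_comp_of_integrable hint).trans ?_
    simp [h1]
  simp only [h2] at h3
  rw [integral_const_mul] at h3
  have hl : (l + 1 : ℂ) ≠ 0 := by exact_mod_cast l.succ_ne_zero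
  rw [← mul_left_cancel₀ hl h3, integral_mul_const, integral_complex_ofReal]
  congr 2
  have hgi : IntegrableOn g (Icc (-1) 1) := integrableOn_legendre_sub_one_mul hρ l
  have hx := measurePreserving_inner x
  have h4 : ∫ y : Sphere2, g (inner ℝ x.1 y.1) ∂surfaceMeasure =
      ∫ t, g t ∂(ENNReal.ofReal (2 * Real.pi) • volume.restrict (Icc (-1) 1)) := by
    rw [← hx.map_eq, integral_map hx.measurable.aemeasurable]
    rw [hx.map_eq]
    exact hgi.aestronglyMeasurable.smul_measure _
  rw [h4, integral_smul_measure, ENNReal.toReal_ofReal (by positivity), smul_eq_mul,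
    nonlocalEigenvalue, intervalIntegral.integral_of_le (by norm_num), integral_Icc_eq_integral_Ioc]

/-! ### Truncated kernels and the principal value. -/

/-- The kernel `ρ` cut off at distances `≤ ε`. -/
def truncatedKernel (ρ : ℝ → ℝ) (ε : ℝ) : ℝ → ℝ := (Ioi ε).indicator ρ

theorem truncatedKernel_admissible {ρ : ℝ → ℝ} (hρ : IsAdmissibleKernel ρ) (ε : ℝ) :
    IsAdmissibleKernel (truncatedKernel ρ ε) := by
  have hs : MeasurableSet {t : ℝ | ε < √(2 * (1 - t))} :=
    measurableSet_lt measurable_const (by fun_prop)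
  refine (Integrable.indicator hρ hs).congr (Eventually.of_forall fun t => ?_)
  by_cases h : ε < √(2 * (1 - t))
  · simp only [truncatedKernel]
    rw [indicator_of_mem (show t ∈ {t : ℝ | ε < √(2 * (1 - t))} from h),
      indicator_of_mem (show _ ∈ Ioi ε from h)]
  · simp only [truncatedKernel]
    rw [indicator_of_notMem (show t ∉ {t : ℝ | ε < √(2 * (1 - t))} from h),
      indicator_of_notMem (show _ ∉ Ioi ε from h), mul_zero]

theorem integrableOn_truncatedKernel {ρ : ℝ → ℝ} (hρ : IsAdmissibleKernel ρ) {ε : ℝ} (hε : 0 < ε) :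
    IntegrableOn (fun t : ℝ => truncatedKernel ρ ε √(2 * (1 - t))) (Icc (-1) 1) := by
  have hpos : ∀ t : ℝ, max (1 - t) (ε ^ 2 / 2) ≠ 0 := fun t =>
    (lt_max_of_lt_right (by positivity)).ne'
  -- A continuous substitute for `1 / (1 - t)`: the two agree where the truncated kernel can be
  -- nonzero, namely for `1 - t > ε² / 2`.
  have hc : Continuous fun t : ℝ => (max (1 - t) (ε ^ 2 / 2))⁻¹ :=
    Continuous.inv₀ (by fun_prop) hpos
  refine (IntegrableOn.continuousOn_mul hc.continuousOn (truncatedKernel_admissible hρ ε)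
    isCompact_Icc).congr (Eventually.of_forall fun t => ?_)
  simp only
  by_cases h : ε < √(2 * (1 - t))
  · have h1 : ε ^ 2 < 2 * (1 - t) := (Real.lt_sqrt hε.le).1 h
    have h2 : ε ^ 2 / 2 < 1 - t := by linarith
    have h3 : 1 - t ≠ 0 := by
      have : 0 < ε ^ 2 / 2 := by positivity
      linarith
    rw [max_eq_left h2.le, inv_mul_cancel_left₀ h3]
  · rw [truncatedKernel, indicator_of_notMem (show _ ∉ Ioi ε from h)]
    simp

/-- The longitude is discontinuous, so continuity is read off from the polynomial expression in
Cartesian coordinates. -/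
theorem continuous_sphericalHarmonic {l : ℕ} {m : ℤ} (hm : m.natAbs ≤ l) :
    Continuous (sphericalHarmonic l m) := by
  obtain ⟨K, hK⟩ := sphericalHarmonic_eq_solidHarmonic l hm
  rw [show sphericalHarmonic l m = _ from funext hK]
  exact continuous_const.mul ((continuous_solidHarmonic _ _).comp continuous_subtype_val)

theorem integrable_nonlocalIntegrand_truncated {ρ : ℝ → ℝ} (hρ : IsAdmissibleKernel ρ) {ε : ℝ}
    (hε : 0 < ε) {u : Sphere2 → ℂ} (hu : Continuous u) (x : Sphere2) :
    Integrable (nonlocalIntegrand (truncatedKernel ρ ε) u x) surfaceMeasure := by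
  have hx := measurePreserving_inner x
  have h1 : Integrable (fun t : ℝ => truncatedKernel ρ ε √(2 * (1 - t)))
      (ENNReal.ofReal (2 * Real.pi) • volume.restrict (Icc (-1) 1)) :=
    (integrableOn_truncatedKernel hρ hε).smul_measure ENNReal.ofReal_ne_top
  have h2 := (hx.integrable_comp_of_integrable h1).ofReal (𝕜 := ℂ)
  have h3 : IntegrableOn (fun y : Sphere2 => ((truncatedKernel ρ ε (dist x y) : ℝ) : ℂ)) univ
      surfaceMeasure := by
    rw [integrableOn_univ]
    simp only [dist_eq_sqrt_inner]
    exact h2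
  have h4 := h3.mul_continuousOn (g' := fun y => u y - u x)
    (hu.sub continuous_const).continuousOn isCompact_univ
  rwa [integrableOn_univ] at h4

theorem indicator_nonlocalIntegrand (ρ : ℝ → ℝ) (ε : ℝ) (u : Sphere2 → ℂ) (x : Sphere2) :
    {y | ε < dist x y}.indicator (nonlocalIntegrand ρ u x) =
      nonlocalIntegrand (truncatedKernel ρ ε) u x := by
  funext y
  by_cases h : ε < dist x y
  · rw [indicator_of_mem (show y ∈ {y | ε < dist x y} from h), nonlocalIntegrand,
      nonlocalIntegrand, truncatedKernel, indicator_of_mem (show _ ∈ Ioi ε from h)]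
  · rw [indicator_of_notMem (show y ∉ {y | ε < dist x y} from h), nonlocalIntegrand,
      truncatedKernel, indicator_of_notMem (show _ ∉ Ioi ε from h)]
    simp

/-- Dominated convergence: the untruncated integrand dominates, and for each `t < 1` the truncation
is inactive once `ε < √(2(1 - t))`. -/
theorem tendsto_nonlocalEigenvalue_truncated {ρ : ℝ → ℝ} (hρ : IsAdmissibleKernel ρ) (l : ℕ) :
    Tendsto (fun ε => nonlocalEigenvalue (truncatedKernel ρ ε) l) (𝓝[>] 0)
      (𝓝 (nonlocalEigenvalue ρ l)) := by
  refine Tendsto.const_mul _ ?_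
  refine intervalIntegral.tendsto_integral_filter_of_dominated_convergence
    (fun t => ‖((legendreP l).eval t - 1) * ρ √(2 * (1 - t))‖) ?_ ?_
    (intervalIntegrable_legendre_sub_one_mul hρ l).norm ?_
  · exact Eventually.of_forall fun ε => (intervalIntegrable_legendre_sub_one_mul
      (truncatedKernel_admissible hρ ε) l).def'.aestronglyMeasurable
  · refine Eventually.of_forall fun ε => Eventually.of_forall fun t _ => ?_
    rw [norm_mul, norm_mul]
    gcongr
    exact norm_indicator_le_norm_self _ _
  · filter_upwards [compl_mem_ae_iff.2 (measure_singleton (1 : ℝ))] with t ht1 ht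
    rw [uIoc_of_le (by norm_num)] at ht
    have hlt : t < 1 := lt_of_le_of_ne ht.2 ht1
    have hpos : 0 < √(2 * (1 - t)) := Real.sqrt_pos.2 (by linarith)
    refine tendsto_const_nhds.congr' ?_
    filter_upwards [mem_nhdsWithin_of_mem_nhds (Iio_mem_nhds hpos)] with ε hε
    rw [truncatedKernel, indicator_of_mem (show _ ∈ Ioi ε from hε)]

theorem isNonlocalEigenfunction_sphericalHarmonic {ρ : ℝ → ℝ} (hρ : IsAdmissibleKernel ρ) {l : ℕ}
    {m : ℤ} (hm : m.natAbs ≤ l) :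
    IsNonlocalEigenfunction ρ (sphericalHarmonic l m) (nonlocalEigenvalue ρ l) := by
  have hms : ∀ (x : Sphere2) (ε : ℝ), MeasurableSet {y : Sphere2 | ε < dist x y} := fun x ε =>
    measurableSet_lt measurable_const (by fun_prop)
  have hI : ∀ (x : Sphere2) (ε : ℝ), 0 < ε → Integrable
      (nonlocalIntegrand (truncatedKernel ρ ε) (sphericalHarmonic l m) x) surfaceMeasure :=
    fun x ε hε => integrable_nonlocalIntegrand_truncated hρ hε (continuous_sphericalHarmonic hm) x
  refine ⟨sphericalHarmonic_ne_zero l hm, fun x => ⟨fun ε hε => ?_, ?_⟩,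
    fun x hx => integral_nonlocalIntegrand hρ hm x hx⟩
  · rw [← integrable_indicator_iff (hms x ε), indicator_nonlocalIntegrand]
    exact hI x ε hε
  · refine Tendsto.congr' (f₁ := fun ε => (nonlocalEigenvalue (truncatedKernel ρ ε) l : ℂ) *
      sphericalHarmonic l m x) ?_ ?_
    · filter_upwards [self_mem_nhdsWithin] with ε hε
      rw [← integral_indicator (hms x ε), indicator_nonlocalIntegrand,
        integral_nonlocalIntegrand (truncatedKernel_admissible hρ ε) hm x (hI x ε hε)]
    · exact ((Complex.continuous_ofReal.tendsto _).comp
        (tendsto_nonlocalEigenvalue_truncated hρ l)).mul_const _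

/-! ### The weakly singular kernel. -/

theorem weaklySingularKernel_admissible {α : ℝ} (hα : -1 < α) (δ : ℝ) :
    IsAdmissibleKernel (weaklySingularKernel α δ) := by
  have h1 : IntervalIntegrable (fun t : ℝ => (1 - t) ^ α) volume (-1) 1 := by
    have := (intervalIntegral.intervalIntegrable_rpow' hα (a := 2) (b := 0)).comp_sub_left 1
    norm_num at this
    exact this
  rw [intervalIntegrable_iff_integrableOn_Icc_of_le (by norm_num)] at h1
  have hs : MeasurableSet {t : ℝ | √(2 * (1 - t)) ∈ Icc 0 δ} :=
    (by fun_prop : Measurable fun t : ℝ => √(2 * (1 - t))) measurableSet_Icc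
  unfold IsAdmissibleKernel
  -- The endpoint `t = 1` is dropped because `(1 - t) / (1 - t)^(1 - α) = (1 - t)^α` can fail there:
  -- for `α = 0` the right side is `0 ^ 0 = 1`.
  rw [integrableOn_Icc_iff_integrableOn_Ico] at h1 ⊢
  refine IntegrableOn.congr_fun (Integrable.indicator
    (h1.const_mul ((1 + α) * 2 ^ (1 + α) / (Real.pi * δ ^ (2 + 2 * α)))) hs) ?_ measurableSet_Ico
  intro t ht
  have hpos : 0 < 1 - t := by linarith [ht.2]
  simp only
  rw [weaklySingularKernel_sqrt α δ ht.2.le]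
  by_cases h : √(2 * (1 - t)) ∈ Icc 0 δ
  · rw [indicator_of_mem (show t ∈ {t : ℝ | √(2 * (1 - t)) ∈ Icc 0 δ} from h), indicator_of_mem h]
    have h2 : (1 - t) ^ α = (1 - t) / (1 - t) ^ (1 - α) := by
      have := Real.rpow_sub hpos 1 (1 - α)
      rwa [sub_sub_cancel, Real.rpow_one] at this
    rw [h2, mul_one, ← mul_div_assoc, div_mul_eq_mul_div, div_div]
    ring
  · rw [indicator_of_notMem (show t ∉ {t : ℝ | √(2 * (1 - t)) ∈ Icc 0 δ} from h),
      indicator_of_notMem h]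
    simp

theorem weaklySingularKernel_sqrt_of_le {α δ t : ℝ} (hδ : 0 < δ) (ht : 1 - δ ^ 2 / 2 ≤ t)
    (ht1 : t ≤ 1) : weaklySingularKernel α δ √(2 * (1 - t)) =
      (1 + α) * 2 ^ (1 + α) / (Real.pi * δ ^ (2 + 2 * α) * (1 - t) ^ (1 - α)) := by
  rw [weaklySingularKernel_sqrt α δ ht1, indicator_of_mem, mul_one]
  exact ⟨Real.sqrt_nonneg _, Real.sqrt_le_iff.2 ⟨hδ.le, by linarith⟩⟩

theorem weaklySingularKernel_sqrt_of_lt {α δ t : ℝ} (ht : t < 1 - δ ^ 2 / 2) :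
    weaklySingularKernel α δ √(2 * (1 - t)) = 0 := by
  rw [weaklySingularKernel, indicator_of_notMem, mul_zero]
  exact fun h => absurd ((Real.sqrt_le_iff.1 h.2).2) (by linarith)

theorem nonlocalEigenvalue_weaklySingularKernel {α δ : ℝ} (hα : -1 < α) (hδ : 0 < δ)
    (hδ2 : δ ≤ 2) (l : ℕ) :
    nonlocalEigenvalue (weaklySingularKernel α δ) l =
      2 * Real.pi * ∫ t in (1 - δ ^ 2 / 2)..1,
        ((legendreP l).eval t - 1) * weaklySingularKernel α δ √(2 * (1 - t)) := by
  have hd : -1 ≤ 1 - δ ^ 2 / 2 := by nlinarith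
  have hd1 : 1 - δ ^ 2 / 2 ≤ 1 := by nlinarith
  have hi := intervalIntegrable_legendre_sub_one_mul (weaklySingularKernel_admissible hα δ) l
  have hdm : 1 - δ ^ 2 / 2 ∈ uIcc (-1 : ℝ) 1 := by
    rw [uIcc_of_le (by norm_num)]; exact ⟨hd, hd1⟩
  rw [nonlocalEigenvalue, ← intervalIntegral.integral_add_adjacent_intervals
    (hi.mono_set (uIcc_subset_uIcc_left hdm)) (hi.mono_set (uIcc_subset_uIcc_right hdm)),
    intervalIntegral.integral_zero_ae, zero_add]
  -- At `t = 1 - δ² / 2` the distance equals `δ` and the cutoff still equals `1`, so this single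
  -- point is discarded.
  filter_upwards [compl_mem_ae_iff.2 (measure_singleton (1 - δ ^ 2 / 2 : ℝ))] with t ht1 ht
  rw [uIoc_of_le hd] at ht
  rw [weaklySingularKernel_sqrt_of_lt (lt_of_le_of_ne ht.2 ht1), mul_zero]

theorem eqOn_legendre_sub_one_mul_weaklySingularKernel {α δ : ℝ} (hδ : 0 < δ) (l : ℕ) :
    EqOn (fun t : ℝ => ((legendreP l).eval t - 1) * weaklySingularKernel α δ √(2 * (1 - t)))
      (fun t : ℝ => ((legendreP l).eval t - 1) *
        ((1 + α) * 2 ^ (1 + α) / (Real.pi * δ ^ (2 + 2 * α) * (1 - t) ^ (1 - α))))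
      (uIcc (1 - δ ^ 2 / 2) 1) := by
  intro t ht
  rw [uIcc_of_le (by linarith [sq_nonneg δ])] at ht
  simp only
  rw [weaklySingularKernel_sqrt_of_le hδ ht.1 ht.2]

end NonlocalSphere

end

open NonlocalSphere in
theorem mainTheorem2 :
    (∀ ρ : ℝ → ℝ, IsAdmissibleKernel ρ → ∀ l : ℕ,
      IntervalIntegrable
        (fun t : ℝ => ((legendreP l).eval t - 1) * ρ √(2 * (1 - t))) volume (-1) 1 ∧
      ∀ m : ℤ, -(l : ℤ) ≤ m → m ≤ (l : ℤ) →
        IsNonlocalEigenfunction ρ (sphericalHarmonic l m) (nonlocalEigenvalue ρ l)) ∧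
    (∀ α δ : ℝ, -1 < α → α < 1 → 0 < δ → δ ≤ 2 →
      IsAdmissibleKernel (weaklySingularKernel α δ) ∧
      ∀ l : ℕ,
        IntervalIntegrable
          (fun t : ℝ => ((legendreP l).eval t - 1) *
            ((1 + α) * 2 ^ (1 + α) / (Real.pi * δ ^ (2 + 2 * α) * (1 - t) ^ (1 - α))))
          volume (1 - δ ^ 2 / 2) 1 ∧
        nonlocalEigenvalue (weaklySingularKernel α δ) l =
          2 * Real.pi * ∫ t in (1 - δ ^ 2 / 2)..1,
            ((legendreP l).eval t - 1) * weaklySingularKernel α δ √(2 * (1 - t)) ∧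
        nonlocalEigenvalue (weaklySingularKernel α δ) l =
          2 * Real.pi * ∫ t in (1 - δ ^ 2 / 2)..1,
            ((legendreP l).eval t - 1) *
              ((1 + α) * 2 ^ (1 + α) / (Real.pi * δ ^ (2 + 2 * α) * (1 - t) ^ (1 - α))) ∧
        ∀ m : ℤ, -(l : ℤ) ≤ m → m ≤ (l : ℤ) →
          IsNonlocalEigenfunction (weaklySingularKernel α δ) (sphericalHarmonic l m)
            (2 * Real.pi * ∫ t in (1 - δ ^ 2 / 2)..1,
              ((legendreP l).eval t - 1) *
                ((1 + α) * 2 ^ (1 + α) /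
                  (Real.pi * δ ^ (2 + 2 * α) * (1 - t) ^ (1 - α))))) := by
  refine ⟨fun ρ hρ l => ⟨intervalIntegrable_legendre_sub_one_mul hρ l, fun m hm hm' =>
    isNonlocalEigenfunction_sphericalHarmonic hρ (by lia)⟩, fun α δ hα _ hδ hδ2 => ?_⟩
  have hadm := weaklySingularKernel_admissible hα δ
  refine ⟨hadm, fun l => ?_⟩
  have heq := eqOn_legendre_sub_one_mul_weaklySingularKernel (α := α) hδ l
  have hval := nonlocalEigenvalue_weaklySingularKernel hα hδ hδ2 l
  have hval' := hval
  rw [intervalIntegral.integral_congr heq] at hval'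
  refine ⟨?_, hval, hval', fun m hm hm' => ?_⟩
  · have hdm : 1 - δ ^ 2 / 2 ∈ uIcc (-1 : ℝ) 1 := by
      rw [uIcc_of_le (by norm_num)]
      constructor <;> nlinarith
    exact ((intervalIntegrable_legendre_sub_one_mul hadm l).mono_set
      (uIcc_subset_uIcc_right hdm)).congr_uIoo (heq.mono uIoo_subset_uIcc_self)
  · rw [← hval']
    exact isNonlocalEigenfunction_sphericalHarmonic hadm (by lia)
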